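/- Consider three qubits $A,B,C$ with state space $\mathbb C^2\otimes\mathbb C^2\otimes\mathbb C^2$. A two-qubit gate is a unitary on $A\otimes B\otimes C$ that acts as a $4\times4$ unitary on one of the pairs $AB$, $AC$, $BC$ and as the identity on the remaining qubit. A circuit of $k$ two-qubit gates (without ancilla) implements a three-qubit gate $G$ if the product of its gates equals $G$. For $\theta_1,\theta_2\in\mathbb R$ let $$V(\theta_1,\theta_2)=\mathrm{diag}(1,1,1,1,1,1,e^{i\theta_1},e^{i\theta_2})$$ in the basis $|abc\rangle$ ordered lexicographically, i.e. the controlled-controlled gate with controls $A,B$, target $C$ and target unitary $\mathrm{diag}(e^{i\theta_1},e^{i\theta_2})$. (1) If $e^{i\theta_1}\neq e^{i\theta_2}$ and $e^{i(\theta_1+\theta_2)}\neq1$, then the least number of two-qubit gates in a circuit implementing $V(\theta_1,\theta_2)$ is $5$. (2) If $e^{i\theta_1}\neq e^{i\theta_2}$ and $e^{i(\theta_1+\theta_2)}=1$, then the least number of two-qubit gates in a circuit implementing $V(\theta_1,\theta_2)$ is $4$. (3) Suppose $e^{i(\theta_1+\theta_2)}=1$, put $\theta=\theta_2$, so that $V(\theta_1,\theta_2)=V(-\theta,\theta)$,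 and let $W=\mathrm{diag}(e^{-i\theta/2},e^{i\theta/2})$. There is a unitary $U$ on $B\otimes C$ with $$U\,(I_B\otimes W_C)\,U^\dagger=\mathrm{diag}(e^{i\theta/2},e^{-i\theta/2},e^{-i\theta/2},e^{i\theta/2})$$ (basis $|bc\rangle$ ordered $00,01,10,11$), and for every such $U$ the circuit of four two-qubit gates $$\Lambda_{AC}(W)\;U_{BC}\;\Lambda_{AC}(W)\;U_{BC}^\dagger$$ (the rightmost gate is applied first), where $\Lambda_{AC}(W)=|0\rangle\langle0|_A\otimes I_C+|1\rangle\langle1|_A\otimes W_C$ acts as the identity on $B$, implements $V(\theta_1,\theta_2)$. -/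

import Mathlib

open scoped Matrix Kronecker

/-- Basis labels `(x, y)` of a two-qubit system. -/
abbrev TwoQubits := Fin 2 × Fin 2

/-- Basis labels `(a, b, c)` of the three-qubit system `ABC`. -/
abbrev ThreeQubits := Fin 2 × Fin 2 × Fin 2

/-- `U` acting on the qubits `A, B` (in this order), identity on `C`. -/
def onAB (U : Matrix TwoQubits TwoQubits ℂ) : Matrix ThreeQubits ThreeQubits ℂ :=
  Matrix.of fun p q => U (p.1, p.2.1) (q.1, q.2.1) * (1 : Matrix (Fin 2) (Fin 2) ℂ) p.2.2 q.2.2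

/-- `U` acting on the qubits `A, C` (in this order), identity on `B`. -/
def onAC (U : Matrix TwoQubits TwoQubits ℂ) : Matrix ThreeQubits ThreeQubits ℂ :=
  Matrix.of fun p q => U (p.1, p.2.2) (q.1, q.2.2) * (1 : Matrix (Fin 2) (Fin 2) ℂ) p.2.1 q.2.1

/-- `U` acting on the qubits `B, C` (in this order), identity on `A`. -/
def onBC (U : Matrix TwoQubits TwoQubits ℂ) : Matrix ThreeQubits ThreeQubits ℂ :=
  Matrix.of fun p q => U (p.2.1, p.2.2) (q.2.1, q.2.2) * (1 : Matrix (Fin 2) (Fin 2) ℂ) p.1 q.1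

/-- A two-qubit gate inside the system `ABC`: a `4 × 4` unitary acting on one of the pairs
`AB`, `AC`, `BC`. -/
def IsTwoQubitGate (G : Matrix ThreeQubits ThreeQubits ℂ) : Prop :=
  ∃ U ∈ Matrix.unitaryGroup TwoQubits ℂ, G = onAB U ∨ G = onAC U ∨ G = onBC U

/-- The circuit `L` consists of two-qubit gates and its product is `G`. The gates are listed in
operator order: the last entry of the list is applied first. -/
def Implements (L : List (Matrix ThreeQubits ThreeQubits ℂ))
    (G : Matrix ThreeQubits ThreeQubits ℂ) : Prop :=
  (∀ g ∈ L, IsTwoQubitGate g) ∧ L.prod = G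

/-- The numbers `k` such that `G` is implemented by a circuit of exactly `k` two-qubit gates. -/
def gateCounts (G : Matrix ThreeQubits ThreeQubits ℂ) : Set ℕ :=
  {k | ∃ L : List (Matrix ThreeQubits ThreeQubits ℂ), L.length = k ∧ Implements L G}

/-- `exp (i t)`. -/
noncomputable def phase (t : ℝ) : ℂ := Complex.exp (t * Complex.I)

/-- The controlled-controlled gate `V(θ₁, θ₂) = diag(1, 1, 1, 1, 1, 1, e^{iθ₁}, e^{iθ₂})`, with
controls `A, B` and target `C`. -/
noncomputable def ccGate (θ₁ θ₂ : ℝ) : Matrix ThreeQubits ThreeQubits ℂ :=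
  Matrix.diagonal fun p =>
    if p.1 = 1 ∧ p.2.1 = 1 then (if p.2.2 = 0 then phase θ₁ else phase θ₂) else 1

/-- The one-qubit gate `W = diag(e^{-iθ/2}, e^{iθ/2})`. -/
noncomputable def gateW (θ : ℝ) : Matrix (Fin 2) (Fin 2) ℂ :=
  Matrix.diagonal ![phase (-θ / 2), phase (θ / 2)]

/-- The controlled gate `|0⟩⟨0| ⊗ I + |1⟩⟨1| ⊗ W`, control on the first qubit. -/
noncomputable def controlled (W : Matrix (Fin 2) (Fin 2) ℂ) : Matrix TwoQubits TwoQubits ℂ :=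
  Matrix.single 0 0 1 ⊗ₖ (1 : Matrix (Fin 2) (Fin 2) ℂ) + Matrix.single 1 1 1 ⊗ₖ W

/-- The diagonal matrix `diag(e^{iθ/2}, e^{-iθ/2}, e^{-iθ/2}, e^{iθ/2})` in the basis
`00, 01, 10, 11` of two qubits. -/
noncomputable def parityPhase (θ : ℝ) : Matrix TwoQubits TwoQubits ℂ :=
  Matrix.diagonal fun p => if p.1 = p.2 then phase (θ / 2) else phase (-θ / 2)

/-- The four-gate circuit: first `U†` on `BC`, then controlled-`W` on `AC` (control `A`), then `U`
on `BC`, then again controlled-`W` on `AC`. -/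
noncomputable def fourGateCircuit (θ : ℝ) (U : Matrix TwoQubits TwoQubits ℂ) :
    List (Matrix ThreeQubits ThreeQubits ℂ) :=
  [onAC (controlled (gateW θ)), onBC U, onAC (controlled (gateW θ)), onBC Uᴴ]

/-! Lower bounds. Circuits can be padded with identities, and adjacent gates on the same pair merge,
so it suffices to exclude circuits of exactly three or four gates. Describe each gate by the qubit
it leaves alone. Up to permuting qubits and reversing the circuit by transposition, the four-gate
patterns that do not merge are the alternating `X₁ Y X₂ Z`, where both `X`s omit one qubit and `Z`
omits another, and the cyclic `X₁ Y Z X₂`, where `X₁`, `Y`, `Z` omit different qubits and `X₂` omits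
the same one as `X₁`. Both are studied for an arbitrary diagonal unitary `g`.

Alternating (`false_of_alternating`): let the `X`s act on `AB` and `Z` on `BC`. Since `Y` commutes
with all operators on `A` or all operators on `B`, the operator `g Z⁻¹` conjugates a copy of `M₂`
inside the operators on `AB` into operators on `AB`. Compare blocks with respect to `A`. An
off-diagonal block `q` of the copy makes `q ⊗ 1` conjugate to `R D₀ ⊕ R D₁`, where `D_r` holds the
relative phases of `g`. If `D₀`, `D₁` are not proportional and have different determinants,
Cayley–Hamilton gives `det q = 0`. A linear space of singular `2 × 2` matrices has a common left or
right kernel vector, and `M₂` has no characters, so the off-diagonal blocks vanish. The diagonal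
blocks then exhaust `M₂`, and the phases force a conjugate of `M₂` to be commutative, which is
absurd.

Cyclic (`exists_algHom_diagonal_mul`, `diagonal_normalizer`): the relative phase of `g` between the
two values of `C` normalizes a copy of `M₂` in `M₄`. By Skolem–Noether it is conjugate to a tensor
product, so its four eigenvalues split into two pairs of equal product. For the phases `1, 1, u, v`
this needs `u = v` or `u v = 1`.

Upper bounds come from explicit circuits: five gates via `a + b - (a ⊕ b) = 2ab`, and four gates by
multiplying `W` with a conjugate that cancels it when `b = 0` and doubles its phases when `b = 1`.
-/

namespace Matrix

/-! ### Endomorphisms of `M₂` and spaces of singular `2 × 2` matrices -/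

/-- An algebra endomorphism of the `2 × 2` matrices is inner. -/
theorem exists_conj_of_algHom (θ : Matrix (Fin 2) (Fin 2) ℂ →ₐ[ℂ] Matrix (Fin 2) (Fin 2) ℂ) :
    ∃ a b : Matrix (Fin 2) (Fin 2) ℂ, a * b = 1 ∧ b * a = 1 ∧ ∀ p, θ p = a * p * b := by
  have hinj : Function.Injective θ := θ.toRingHom.injective
  have hbij : Function.Bijective θ :=
    ⟨hinj, (LinearMap.injective_iff_surjective (f := θ.toLinearMap)).1 hinj⟩
  let e := AlgEquiv.ofBijective θ hbij
  let t := Matrix.toLinAlgEquiv' (R := ℂ) (n := Fin 2)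
  -- Skolem–Noether in its form for the endomorphism algebra of a vector space, transported to
  -- matrices along `t`.
  obtain ⟨T, hT⟩ := ((t.symm.trans e).trans t).eq_linearEquivConjAlgEquiv
  refine ⟨t.symm T.toLinearMap, t.symm T.symm.toLinearMap, ?_, ?_, fun p => ?_⟩
  · rw [← map_mul, ← map_one t.symm]; congr 1; ext; simp
  · rw [← map_mul, ← map_one t.symm]; congr 1; ext; simp
  · have h := DFunLike.congr_fun hT (t p)
    apply t.injective
    simp only [map_mul, AlgEquiv.apply_symm_apply]
    simp only [AlgEquiv.trans_apply, AlgEquiv.symm_apply_apply] at h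
    change t (θ p) = _ at h
    rw [h]
    rfl

theorem surjective_of_algHom (θ : Matrix (Fin 2) (Fin 2) ℂ →ₐ[ℂ] Matrix (Fin 2) (Fin 2) ℂ) :
    Function.Surjective θ :=
  (LinearMap.injective_iff_surjective (f := θ.toLinearMap)).1 θ.toRingHom.injective

/-- A singular `N` has the form `x yᵀ`, so `(N v)ᵢ (z N)ⱼ = Nᵢⱼ (z · N v)`. -/
theorem mulVec_eq_zero_or_vecMul_eq_zero {N : Matrix (Fin 2) (Fin 2) ℂ} {v z : Fin 2 → ℂ}
    (hN : N.det = 0) (h : z ⬝ᵥ (N *ᵥ v) = 0) : N *ᵥ v = 0 ∨ z ᵥ* N = 0 := by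
  rw [det_fin_two] at hN
  simp only [dotProduct, mulVec, Fin.sum_univ_two] at h
  have key : ∀ i j, (N *ᵥ v) i * (z ᵥ* N) j = 0 := by
    intro i j
    simp only [mulVec, vecMul, dotProduct, Fin.sum_univ_two]
    fin_cases i <;> fin_cases j <;> simp only [Fin.zero_eta, Fin.mk_one, Fin.isValue]
    · linear_combination N 0 0 * h - z 1 * v 1 * hN
    · linear_combination N 0 1 * h + z 1 * v 0 * hN
    · linear_combination N 1 0 * h + z 0 * v 1 * hN
    · linear_combination N 1 1 * h - z 0 * v 0 * hN
  by_contra! hc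
  obtain ⟨i, hi⟩ := Function.ne_iff.1 hc.1
  obtain ⟨j, hj⟩ := Function.ne_iff.1 hc.2
  exact mul_ne_zero hi hj (key i j)

/-- A linear space of singular `2 × 2` matrices has a common kernel vector or a common left kernel
vector. -/
theorem exists_common_kernel_of_det_eq_zero {V : Type*} [AddCommGroup V] [Module ℂ V]
    (f : V →ₗ[ℂ] Matrix (Fin 2) (Fin 2) ℂ) (hf : ∀ p, (f p).det = 0) :
    (∃ v ≠ 0, ∀ p, f p *ᵥ v = 0) ∨ ∃ w ≠ 0, ∀ p, w ᵥ* f p = 0 := by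
  by_cases h0 : ∀ p, f p = 0
  · exact Or.inl ⟨fun _ => 1, fun h => one_ne_zero (congrFun h 0), fun p => by simp [h0 p]⟩
  push Not at h0
  obtain ⟨p₀, hp₀⟩ := h0
  obtain ⟨v, hv, hMv⟩ := exists_mulVec_eq_zero_iff.2 (hf p₀)
  obtain ⟨z, hz, hzM⟩ := exists_vecMul_eq_zero_iff.2 (hf p₀)
  -- The nonzero singular `f p₀` has adjugate proportional to `v zᵀ`, so `z · N v` is a multiple of
  -- the polarized determinant of `f p₀` and `N`. That vanishes because both matrices and their sum
  -- are singular.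
  have key : ∀ p, z ⬝ᵥ (f p *ᵥ v) = 0 := by
    intro p
    have h1 := hf p₀
    have h2 := hf p
    have h3 := hf (p₀ + p)
    rw [map_add] at h3
    generalize f p₀ = M at *
    generalize f p = N at *
    simp only [det_fin_two, add_apply] at h1 h2 h3
    have hB : M 0 0 * N 1 1 + N 0 0 * M 1 1 - M 0 1 * N 1 0 - N 0 1 * M 1 0 = 0 := by
      linear_combination h3 - h1 - h2
    have a0 := congrFun hMv 0
    have a1 := congrFun hMv 1
    have b0 := congrFun hzM 0
    have b1 := congrFun hzM 1
    simp only [mulVec, vecMul, dotProduct, Fin.sum_univ_two, Pi.zero_apply] at a0 a1 b0 b1 ⊢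
    have hne : ∃ i j, M i j ≠ 0 := by
      by_contra! hc
      exact hp₀ (ext hc)
    obtain ⟨i, j, hij⟩ := hne
    apply (mul_eq_zero.1 _).resolve_left hij
    fin_cases i <;> fin_cases j <;> simp only [Fin.zero_eta, Fin.mk_one, Fin.isValue] at hij ⊢
    · linear_combination z 1 * v 1 * hB + N 0 0 * v 0 * b0 - N 0 0 * z 1 * a1 + N 0 1 * v 1 * b0 +
        z 1 * N 1 0 * a0
    · linear_combination -z 1 * v 0 * hB + N 0 1 * v 1 * b1 - N 0 1 * z 1 * a1 + N 0 0 * v 0 * b1 +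
        z 1 * N 1 1 * a0
    · linear_combination -z 0 * v 1 * hB + N 1 0 * v 0 * b0 - N 1 0 * z 0 * a0 + N 1 1 * v 1 * b0 +
        z 0 * N 0 0 * a1
    · linear_combination z 0 * v 0 * hB + N 1 1 * v 1 * b1 - N 1 1 * z 0 * a0 + N 1 0 * v 0 * b1 +
        z 0 * N 0 1 * a1
  -- The space is the union of the matrices killing `v` and those killed by `z` on the left; two
  -- proper subspaces cannot cover it.
  by_contra! hc
  obtain ⟨p, hp⟩ := hc.1 v hv
  obtain ⟨q, hq⟩ := hc.2 z hz
  have hp' := (mulVec_eq_zero_or_vecMul_eq_zero (hf p) (key p)).resolve_left hp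
  have hq' := (mulVec_eq_zero_or_vecMul_eq_zero (hf q) (key q)).resolve_right hq
  rcases mulVec_eq_zero_or_vecMul_eq_zero (hf (p + q)) (key (p + q)) with h | h
  · rw [map_add, add_mulVec, hq', add_zero] at h
    exact hp h
  · rw [map_add, vecMul_add, hp', zero_add] at h
    exact hq h

theorem eq_zero_of_mulVec_pair_eq_zero {N : Matrix (Fin 2) (Fin 2) ℂ} {v w : Fin 2 → ℂ}
    (hv : N *ᵥ v = 0) (hw : N *ᵥ w = 0) (h : v 0 * w 1 ≠ v 1 * w 0) : N = 0 := by
  have h' := sub_ne_zero.2 h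
  ext i j
  have a := congrFun hv i
  have b := congrFun hw i
  simp only [mulVec, dotProduct, Fin.sum_univ_two, Pi.zero_apply] at a b
  apply (mul_eq_zero.1 _).resolve_left h'
  fin_cases j <;> simp only [Fin.zero_eta, Fin.mk_one, Fin.isValue]
  · linear_combination w 1 * a - v 1 * b
  · linear_combination v 0 * b - w 0 * a

/-! ### Blocks of representations of `M₂` on two qubits -/

/-- The `(i, j)` block of a two-qubit operator with respect to the first qubit. -/
def qubitBlock {α : Type*} (i j : Fin 2) (T : Matrix TwoQubits TwoQubits α) :
    Matrix (Fin 2) (Fin 2) α :=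
  T.submatrix (fun y => (i, y)) fun y => (j, y)

theorem qubitBlock_mul (i j : Fin 2) (S T : Matrix TwoQubits TwoQubits ℂ) :
    qubitBlock i j (S * T) =
      qubitBlock i 0 S * qubitBlock 0 j T + qubitBlock i 1 S * qubitBlock 1 j T := by
  ext y y'
  simp [qubitBlock, mul_apply, Fintype.sum_prod_type, Fin.sum_univ_two]

theorem qubitBlock_conjTranspose (i j : Fin 2) (T : Matrix TwoQubits TwoQubits ℂ) :
    qubitBlock i j Tᴴ = (qubitBlock j i T)ᴴ := rfl

theorem qubitBlock_one_self (i : Fin 2) :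
    qubitBlock i i (1 : Matrix TwoQubits TwoQubits ℂ) = 1 := by
  ext y y'
  simp [qubitBlock, one_apply]

theorem qubitBlock_algebraMap_self (i : Fin 2) (c : ℂ) :
    qubitBlock i i (algebraMap ℂ (Matrix TwoQubits TwoQubits ℂ) c) = algebraMap ℂ _ c := by
  ext y y'
  simp [qubitBlock, algebraMap_matrix_apply]

/-- An operator representation of the `2 × 2` matrices on two qubits which maps one vector of the
`i` block into the `i` block leaves the `i` block invariant. -/
theorem qubitBlock_eq_zero_of_mulVec_eq_zero
    (φ : Matrix (Fin 2) (Fin 2) ℂ →⋆ₐ[ℂ] Matrix TwoQubits TwoQubits ℂ) {i j : Fin 2} (hij : i ≠ j)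
    {v : Fin 2 → ℂ} (hv : v ≠ 0) (h : ∀ p, qubitBlock j i (φ p) *ᵥ v = 0)
    (p : Matrix (Fin 2) (Fin 2) ℂ) : qubitBlock j i (φ p) = 0 := by
  have hmul : ∀ (k : Fin 2) (S T : Matrix TwoQubits TwoQubits ℂ), qubitBlock k i (S * T) =
      qubitBlock k i S * qubitBlock i i T + qubitBlock k j S * qubitBlock j i T := by
    intro k S T
    rw [qubitBlock_mul]
    have : (i = 0 ∧ j = 1) ∨ (i = 1 ∧ j = 0) := by omega
    rcases this with ⟨rfl, rfl⟩ | ⟨rfl, rfl⟩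
    · rfl
    · exact add_comm _ _
  -- Either the orbit of `v` spans the whole `i` block, which then lies in the kernel, or it stays
  -- on the line of `v` and the eigenvalue is a character of `M₂`.
  by_cases hq : ∃ q, v 0 * (qubitBlock i i (φ q) *ᵥ v) 1 ≠ v 1 * (qubitBlock i i (φ q) *ᵥ v) 0
  · obtain ⟨q, hq⟩ := hq
    refine eq_zero_of_mulVec_pair_eq_zero (h p) ?_ hq
    have := h (p * q)
    rw [map_mul, hmul, add_mulVec, ← mulVec_mulVec, ← mulVec_mulVec, h q, mulVec_zero,
      add_zero] at this
    exact this
  · exfalso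
    push Not at hq
    have hc : ∀ q, ∃ c : ℂ, qubitBlock i i (φ q) *ᵥ v = c • v := by
      intro q
      have h1 := hq q
      generalize qubitBlock i i (φ q) *ᵥ v = w at h1
      by_cases h0 : v 0 = 0
      · have h2 : v 1 ≠ 0 := by
          intro h2
          exact hv (funext fun k => by fin_cases k <;> assumption)
        refine ⟨w 1 / v 1, funext fun k => ?_⟩
        fin_cases k
        · simp only [Fin.zero_eta, Pi.smul_apply, smul_eq_mul]
          field_simp
          linear_combination -h1
        · simp only [Fin.mk_one, Pi.smul_apply, smul_eq_mul]
          field_simp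
      · refine ⟨w 0 / v 0, funext fun k => ?_⟩
        fin_cases k
        · simp only [Fin.zero_eta, Pi.smul_apply, smul_eq_mul]
          field_simp
        · simp only [Fin.mk_one, Pi.smul_apply, smul_eq_mul]
          field_simp
          linear_combination h1
    choose c hc using hc
    have hcm : ∀ q r, c (q * r) = c q * c r := by
      intro q r
      have h1 := hc (q * r)
      rw [map_mul, hmul, add_mulVec, ← mulVec_mulVec, ← mulVec_mulVec, h r, mulVec_zero,
        add_zero, hc r, mulVec_smul, hc q, smul_smul] at h1
      rw [mul_comm (c q)]
      exact (smul_left_injective ℂ hv h1).symm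
    have hc1 : c 1 = 1 := by
      have h1 := hc 1
      rw [map_one, qubitBlock_one_self, one_mulVec] at h1
      refine (smul_left_injective ℂ hv ?_).symm
      simpa using h1
    have hneg : ∀ q, c (-q) = -c q := by
      intro q
      have h1 := hc (-q)
      have h2 : qubitBlock i i (φ (-q)) = -qubitBlock i i (φ q) := by
        rw [map_neg]; rfl
      rw [h2, neg_mulVec, hc q, ← neg_smul] at h1
      exact (smul_left_injective ℂ hv h1).symm
    -- The Pauli matrices X and Z square to one and anticommute, which no pair of scalars does.
    have hx : c !![0, 1; 1, 0] * c !![0, 1; 1, 0] = 1 := by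
      rw [← hcm]; simp [← one_fin_two, hc1]
    have hz : c !![1, 0; 0, -1] * c !![1, 0; 0, -1] = 1 := by
      rw [← hcm]; simp [← one_fin_two, hc1]
    have hxz : c !![0, 1; 1, 0] * c !![1, 0; 0, -1] =
        -(c !![1, 0; 0, -1] * c !![0, 1; 1, 0]) := by
      rw [← hcm, ← hcm, ← hneg]; congr 1; simp
    have : c !![0, 1; 1, 0] * c !![1, 0; 0, -1] = 0 := by linear_combination hxz / 2
    rcases mul_eq_zero.1 this with h0 | h0
    · simp [h0] at hx
    · simp [h0] at hz

theorem qubitBlock_map_conjTranspose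
    (φ : Matrix (Fin 2) (Fin 2) ℂ →⋆ₐ[ℂ] Matrix TwoQubits TwoQubits ℂ) (i j : Fin 2)
    (p : Matrix (Fin 2) (Fin 2) ℂ) : qubitBlock i j (φ pᴴ) = (qubitBlock j i (φ p))ᴴ := by
  rw [← star_eq_conjTranspose, map_star, star_eq_conjTranspose, qubitBlock_conjTranspose]

/-- If all off-diagonal blocks of a representation of the `2 × 2` matrices on two qubits are
singular, then they vanish. -/
theorem qubitBlock_eq_zero_of_det_eq_zero
    (φ : Matrix (Fin 2) (Fin 2) ℂ →⋆ₐ[ℂ] Matrix TwoQubits TwoQubits ℂ)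
    (h : ∀ p, (qubitBlock 0 1 (φ p)).det = 0) {i j : Fin 2} (hij : i ≠ j)
    (p : Matrix (Fin 2) (Fin 2) ℂ) : qubitBlock i j (φ p) = 0 := by
  have hswap : ∀ {i j : Fin 2}, (∀ p, qubitBlock i j (φ p) = 0) → ∀ p, qubitBlock j i (φ p) = 0 := by
    intro i j h p
    rw [← conjTranspose_conjTranspose p, qubitBlock_map_conjTranspose, h, conjTranspose_zero]
  have h01 : ∀ p, qubitBlock 0 1 (φ p) = 0 := by
    let f : Matrix (Fin 2) (Fin 2) ℂ →ₗ[ℂ] Matrix (Fin 2) (Fin 2) ℂ :=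
      { toFun := fun p => qubitBlock 0 1 (φ p)
        map_add' := fun p q => by rw [map_add]; rfl
        map_smul' := fun c p => by rw [map_smul]; rfl }
    rcases exists_common_kernel_of_det_eq_zero f h with ⟨v, hv, hk⟩ | ⟨w, hw, hk⟩
    · exact qubitBlock_eq_zero_of_mulVec_eq_zero φ (by decide) hv hk
    -- Taking adjoints turns the left kernel vector of the `0 1` blocks into a kernel vector of the
    -- `1 0` blocks.
    · refine hswap (qubitBlock_eq_zero_of_mulVec_eq_zero φ (by decide) (star_ne_zero.2 hw) ?_)
      intro p
      have h1 : w ᵥ* qubitBlock 0 1 (φ pᴴ) = 0 := hk pᴴ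
      rw [qubitBlock_map_conjTranspose] at h1
      have h2 := congrArg star h1
      rwa [star_vecMul, conjTranspose_conjTranspose, star_zero] at h2
  have : (i = 0 ∧ j = 1) ∨ (i = 1 ∧ j = 0) := by omega
  rcases this with ⟨rfl, rfl⟩ | ⟨rfl, rfl⟩
  · exact h01 p
  · exact hswap h01 p

/-! ### Diagonal phases and block diagonal conjugation -/

/-- Subtracting the Cayley–Hamilton equation leaves a linear relation between `M` and `1`. Either it
is trivial or it makes `M` scalar. -/
theorem scalar_or_trace_det_eq {M : Matrix (Fin 2) (Fin 2) ℂ} {t δ : ℂ}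
    (h : M * M - t • M + δ • (1 : Matrix (Fin 2) (Fin 2) ℂ) = 0) :
    (∃ c : ℂ, M = c • 1) ∨ (M.trace = t ∧ M.det = δ) := by
  have e : ∀ i j, (M * M - t • M + δ • (1 : Matrix (Fin 2) (Fin 2) ℂ)) i j = 0 := fun i j => by
    rw [h]; rfl
  have e00 := e 0 0
  have e01 := e 0 1
  have e10 := e 1 0
  have e11 := e 1 1
  simp [mul_apply, Fin.sum_univ_two] at e00 e01 e10 e11
  simp only [trace_fin_two, det_fin_two]
  by_cases ht : M 0 0 + M 1 1 = t
  · exact Or.inr ⟨ht, by subst ht; linear_combination -e00⟩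
  · left
    have ht' := sub_ne_zero.2 ht
    refine ⟨M 0 0, ?_⟩
    ext i j
    apply sub_eq_zero.1
    apply (mul_eq_zero.1 _).resolve_left ht'
    fin_cases i <;> fin_cases j <;> simp [-mul_eq_zero]
    · linear_combination e01
    · linear_combination e10
    · linear_combination e11 - e00

end Matrix

namespace Matrix

/-- If `q ⊗ 1` is conjugate to a block diagonal matrix whose blocks `R D₀`, `R D₁` differ by
diagonal factors with `det D₀ ≠ det D₁` and `D₀`, `D₁` not proportional, then `q` is singular. -/
theorem det_eq_zero_of_blockDiagonal_conj {K K' : Matrix TwoQubits TwoQubits ℂ} (hK : K' * K = 1)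
    {q R : Matrix (Fin 2) (Fin 2) ℂ} {d : Fin 2 → Fin 2 → ℂ} (h : K * blockDiagonal (fun _ : Fin 2 => q) * K' =
      blockDiagonal fun r : Fin 2 => R * diagonal (d r))
    (h1 : d 0 0 * d 1 1 ≠ d 0 1 * d 1 0) (h2 : d 0 0 * d 0 1 ≠ d 1 0 * d 1 1) : q.det = 0 := by
  have hK' : K * K' = 1 := mul_eq_one_comm.1 hK
  obtain ⟨M, hM⟩ : ∃ M : Fin 2 → Matrix (Fin 2) (Fin 2) ℂ, M = fun r => R * diagonal (d r) :=
    ⟨_, rfl⟩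
  have hdet : ∀ r, (M r).det = R.det * (d r 0 * d r 1) := by
    intro r
    simp [hM, Fin.prod_univ_two]
  rw [← hM] at h
  have hq : q * q - q.trace • q + q.det • (1 : Matrix (Fin 2) (Fin 2) ℂ) = 0 := by
    ext i j
    simp only [trace_fin_two, det_fin_two]
    fin_cases i <;> fin_cases j <;> simp [mul_apply, Fin.sum_univ_two] <;> ring
  -- The characteristic polynomial of `q` annihilates `q ⊗ 1`, hence its conjugate, hence each
  -- block.
  have hch : ∀ r, M r * M r - q.trace • M r + q.det • (1 : Matrix (Fin 2) (Fin 2) ℂ) = 0 := by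
    have e1 : blockDiagonal (fun r => M r * M r - q.trace • M r + q.det • 1) =
        K * blockDiagonal (fun _ : Fin 2 => q * q - q.trace • q + q.det • 1) * K' := by
      have a1 : blockDiagonal (fun r => M r * M r - q.trace • M r + q.det • 1) =
          blockDiagonal M * blockDiagonal M - q.trace • blockDiagonal M + q.det • 1 := by
        rw [← blockDiagonal_mul, ← blockDiagonal_smul, ← blockDiagonal_sub, ← blockDiagonal_one,
          ← blockDiagonal_smul, ← blockDiagonal_add]
        rfl
      have a2 : blockDiagonal (fun _ : Fin 2 => q * q - q.trace • q + q.det • 1) =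
          blockDiagonal (fun _ => q) * blockDiagonal (fun _ => q) -
            q.trace • blockDiagonal (fun _ => q) + q.det • 1 := by
        rw [← blockDiagonal_mul, ← blockDiagonal_smul, ← blockDiagonal_sub, ← blockDiagonal_one,
          ← blockDiagonal_smul, ← blockDiagonal_add]
        rfl
      rw [a1, a2, ← h]
      have : K * blockDiagonal (fun _ : Fin 2 => q) * K' * (K * blockDiagonal (fun _ => q) * K') =
          K * (blockDiagonal (fun _ => q) * blockDiagonal (fun _ => q)) * K' := by
        calc _ = K * blockDiagonal (fun _ : Fin 2 => q) * (K' * K) * blockDiagonal (fun _ => q) * K' := by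
              simp only [mul_assoc]
          _ = _ := by rw [hK]; simp only [mul_assoc, one_mul]
      rw [this, mul_add, mul_sub, add_mul, sub_mul, mul_smul_comm, smul_mul_assoc, mul_smul_comm,
        smul_mul_assoc, mul_one, hK']
    have e2 : blockDiagonal (fun r => M r * M r - q.trace • M r + q.det • 1) =
        blockDiagonal (fun _ : Fin 2 => (0 : Matrix (Fin 2) (Fin 2) ℂ)) := by
      rw [e1, hq, show (fun _ : Fin 2 => (0 : Matrix (Fin 2) (Fin 2) ℂ)) = 0 from rfl,
        blockDiagonal_zero, mul_zero, zero_mul]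
    exact fun r => congrFun (blockDiagonal_injective e2) r
  have htr : (M 0).trace + (M 1).trace = 2 * q.trace := by
    have := congrArg trace h
    rw [trace_mul_comm, ← mul_assoc, hK, one_mul, trace_blockDiagonal, trace_blockDiagonal,
      Fin.sum_univ_two, Fin.sum_univ_two] at this
    linear_combination -this
  have hscalar : ∀ c : ℂ, (c • (1 : Matrix (Fin 2) (Fin 2) ℂ)).trace = 2 * c ∧
      (c • (1 : Matrix (Fin 2) (Fin 2) ℂ)).det = c ^ 2 := by
    intro c
    simp [mul_comm]
  have hfin : (M 0).det = q.det → (M 1).det = q.det → q.det = 0 := by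
    intro a0 a1
    rw [hdet] at a0 a1
    have : R.det * (d 0 0 * d 0 1 - d 1 0 * d 1 1) = 0 := by linear_combination a0 - a1
    rw [(mul_eq_zero.1 this).resolve_right (sub_ne_zero.2 h2)] at a0
    linear_combination -a0
  -- If the other block has the trace of `q`, the total trace makes the scalar `c` half the trace of
  -- `q`; then `c` being a root of the characteristic polynomial gives `c² = det q`.
  have hmixed : ∀ r s, (M r).trace + (M s).trace = 2 * q.trace → (∃ c : ℂ, M r = c • 1) →
      (M s).trace = q.trace → (M r).det = q.det := by
    rintro r s ht ⟨c, hc⟩ hs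
    have b := congrFun (congrFun (hch r) 0) 0
    rw [hc] at ht b ⊢
    rw [hs, (hscalar c).1] at ht
    rw [(hscalar c).2]
    simp at b
    linear_combination c * ht - b
  rcases scalar_or_trace_det_eq (hch 0) with s0 | ⟨t0, u0⟩ <;>
    rcases scalar_or_trace_det_eq (hch 1) with s1 | ⟨t1, u1⟩
  · obtain ⟨c, hc⟩ := s0
    obtain ⟨c', hc'⟩ := s1
    have e0 : ∀ i j, R i j * d 0 j = if i = j then c else 0 := by
      intro i j
      have := congrFun (congrFun hc i) j
      simpa [hM, mul_diagonal, one_apply] using this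
    have e1 : ∀ i j, R i j * d 1 j = if i = j then c' else 0 := by
      intro i j
      have := congrFun (congrFun hc' i) j
      simpa [hM, mul_diagonal, one_apply] using this
    have a0 := e0 0 0
    have a1 := e0 1 1
    have b0 := e1 0 0
    have b1 := e1 1 1
    simp only [if_true] at a0 a1 b0 b1
    -- Two scalar blocks with `D₀`, `D₁` not proportional: `R` loses a diagonal entry, so `c = 0` is
    -- a root of the characteristic polynomial of `q`.
    have hRR : R 0 0 * R 1 1 * (d 0 0 * d 1 1 - d 0 1 * d 1 0) = 0 := by
      linear_combination R 1 1 * d 1 1 * a0 - R 0 0 * d 1 0 * a1 + c * b1 - c * b0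
    have hc0 : c = 0 := by
      rcases mul_eq_zero.1 ((mul_eq_zero.1 hRR).resolve_right (sub_ne_zero.2 h1)) with h0 | h0
      · rw [← a0, h0, zero_mul]
      · rw [← a1, h0, zero_mul]
    have b := congrFun (congrFun (hch 0) 0) 0
    rw [hc, hc0] at b
    simpa using b
  · exact hfin (hmixed 0 1 htr s0 t1) u1
  · exact hfin u0 (hmixed 1 0 (by rw [add_comm]; exact htr) s1 t0)
  · exact hfin u0 u1

/-- The case without conjugation, which needs no condition on determinants: an invertible `R` could
be cancelled, giving equal phases. -/
theorem det_eq_zero_of_mul_diagonal_eq {q R : Matrix (Fin 2) (Fin 2) ℂ} {d : Fin 2 → Fin 2 → ℂ}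
    (h : ∀ r, q = R * diagonal (d r))
    (h1 : d 0 0 * d 1 1 ≠ d 0 1 * d 1 0) : q.det = 0 := by
  have a := (h 0).symm.trans (h 1)
  by_contra hq
  have hR : R.det ≠ 0 := by
    intro hR
    apply hq
    rw [h 0, det_mul, hR, zero_mul]
  have hdd : diagonal (d 0) = diagonal (d 1) := by
    have hu : IsUnit R.det := hR.isUnit
    have := congrArg (fun m => R⁻¹ * m) a
    simpa only [← mul_assoc, nonsing_inv_mul _ hu, one_mul] using this
  rw [diagonal_injective hdd] at h1
  exact h1 (mul_comm _ _)

/-- Once the off-diagonal blocks vanish, both diagonal blocks are surjective representations of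
`M₂`. So conjugation by `K`, with or without the phases `d`, sends every `m ⊗ 1` to some `α ⊗ 1`.
Nonproportional phases make every such `α` diagonal, embedding `M₂` in a commutative algebra. -/
theorem false_of_singular_blocks
    (φ : Matrix (Fin 2) (Fin 2) ℂ →⋆ₐ[ℂ] Matrix TwoQubits TwoQubits ℂ)
    {K : Matrix TwoQubits TwoQubits ℂ} (hK : Kᴴ * K = 1) {d : Fin 2 → Fin 2 → ℂ}
    (hd : ∀ r y, d r y * star (d r y) = 1)
    (h00 : ∀ p, ∃ α, K * blockDiagonal (fun _ : Fin 2 => qubitBlock 0 0 (φ p)) * Kᴴ =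
      blockDiagonal fun _ : Fin 2 => α)
    (h01 : ∀ p, (qubitBlock 0 1 (φ p)).det = 0)
    (h11 : ∀ p, ∃ β, blockDiagonal (fun r => diagonal (d r)) *
      (K * blockDiagonal (fun _ : Fin 2 => qubitBlock 1 1 (φ p)) * Kᴴ) *
        (blockDiagonal fun r => diagonal (d r))ᴴ = blockDiagonal fun _ : Fin 2 => β)
    (h1 : d 0 0 * d 1 1 ≠ d 0 1 * d 1 0) : False := by
  have hK' : K * Kᴴ = 1 := mul_eq_one_comm.1 hK
  have hoff : ∀ {i j : Fin 2}, i ≠ j → ∀ p, qubitBlock i j (φ p) = 0 :=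
    fun hij p => qubitBlock_eq_zero_of_det_eq_zero φ h01 hij p
  have hmul : ∀ i S T, qubitBlock i i (φ (S * T)) =
      qubitBlock i i (φ S) * qubitBlock i i (φ T) := by
    intro i S T
    rw [map_mul, qubitBlock_mul]
    fin_cases i
    · simp [hoff (i := 0) (j := 1) (by decide)]
    · simp [hoff (i := 1) (j := 0) (by decide)]
  have hsurj : ∀ i : Fin 2, ∀ m, ∃ p, qubitBlock i i (φ p) = m := by
    intro i
    let f : Matrix (Fin 2) (Fin 2) ℂ →ₐ[ℂ] Matrix (Fin 2) (Fin 2) ℂ :=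
      { toFun := fun p => qubitBlock i i (φ p)
        map_one' := by rw [map_one, qubitBlock_one_self]
        map_mul' := hmul i
        map_zero' := by rw [map_zero]; rfl
        map_add' := fun p q => by rw [map_add]; rfl
        commutes' := fun c => by
          rw [AlgHomClass.commutes, qubitBlock_algebraMap_self] }
    exact surjective_of_algHom f
  have key : ∀ m, ∃ α, K * blockDiagonal (fun _ : Fin 2 => m) * Kᴴ =
      blockDiagonal (fun _ : Fin 2 => α) ∧ α 0 1 = 0 ∧ α 1 0 = 0 := by
    intro m
    obtain ⟨p, hp⟩ := hsurj 0 m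
    obtain ⟨q, hq⟩ := hsurj 1 m
    obtain ⟨α, hα⟩ := h00 p
    obtain ⟨β, hβ⟩ := h11 q
    rw [hp] at hα
    rw [hq, hα, blockDiagonal_conjTranspose, ← blockDiagonal_mul, ← blockDiagonal_mul] at hβ
    have hβ' := blockDiagonal_injective hβ
    -- The two blocks of `β ⊗ 1` coincide, so an off-diagonal entry of `α` survives only where `d 0`
    -- and `d 1` give it the same phase factor.
    have e : ∀ i j, (d 0 i * star (d 0 j) - d 1 i * star (d 1 j)) * α i j = 0 := by
      intro i j
      have c0 := congrFun (congrFun (congrFun hβ' 0) i) j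
      have c1 := congrFun (congrFun (congrFun hβ' 1) i) j
      simp only [diagonal_conjTranspose, mul_diagonal, diagonal_mul, Pi.star_apply] at c0 c1
      linear_combination c0 - c1
    refine ⟨α, hα, (mul_eq_zero.1 (e 0 1)).resolve_left ?_,
      (mul_eq_zero.1 (e 1 0)).resolve_left ?_⟩ <;> intro hc <;> apply h1
    · linear_combination d 0 1 * d 1 1 * hc - d 0 0 * d 1 1 * hd 0 1 + d 0 1 * d 1 0 * hd 1 1
    · linear_combination -d 0 0 * d 1 0 * hc + d 0 1 * d 1 0 * hd 0 0 - d 0 0 * d 1 1 * hd 1 0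
  obtain ⟨α, hα, hα01, hα10⟩ := key !![0, 1; 0, 0]
  obtain ⟨β, hβ, hβ01, hβ10⟩ := key !![0, 0; 1, 0]
  have hcomm : α * β = β * α := by
    ext i j
    fin_cases i <;> fin_cases j <;>
      simp [mul_apply, Fin.sum_univ_two, hα01, hα10, hβ01, hβ10, mul_comm]
  have hconj : ∀ m n : Matrix (Fin 2) (Fin 2) ℂ,
      K * blockDiagonal (fun _ : Fin 2 => m) * Kᴴ * (K * blockDiagonal (fun _ : Fin 2 => n) * Kᴴ) =
        K * blockDiagonal (fun _ : Fin 2 => m * n) * Kᴴ := by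
    intro m n
    rw [blockDiagonal_mul]
    calc _ = K * blockDiagonal (fun _ : Fin 2 => m) * (Kᴴ * K) * blockDiagonal (fun _ => n) * Kᴴ := by
          simp only [mul_assoc]
      _ = _ := by rw [hK]; simp only [mul_assoc, one_mul]
  have h2 : K * blockDiagonal (fun _ : Fin 2 => (!![0, 1; 0, 0] * !![0, 0; 1, 0] : Matrix _ _ ℂ)) * Kᴴ =
      K * blockDiagonal (fun _ : Fin 2 => (!![0, 0; 1, 0] * !![0, 1; 0, 0] : Matrix _ _ ℂ)) * Kᴴ := by
    rw [← hconj, ← hconj, hα, hβ, ← blockDiagonal_mul, ← blockDiagonal_mul, hcomm]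
  have h3 := congrArg (fun m => Kᴴ * m * K) h2
  simp only [mul_assoc, hK, mul_one] at h3
  simp only [← mul_assoc, hK, one_mul] at h3
  have h4 := congrFun (congrFun (congrFun (blockDiagonal_injective h3) 0) 0) 0
  simp [mul_apply, Fin.sum_univ_two] at h4

end Matrix

open Matrix

/-! ### Three-qubit operators and gates on pairs of qubits -/

/-- The `i`-`j` block of a three-qubit operator with respect to the qubit `A`. -/
def blockA (i j : Fin 2) (M : Matrix ThreeQubits ThreeQubits ℂ) : Matrix TwoQubits TwoQubits ℂ :=
  M.submatrix (fun s => (i, s)) fun s => (j, s)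

theorem blockA_mul (i j : Fin 2) (M N : Matrix ThreeQubits ThreeQubits ℂ) :
    blockA i j (M * N) = blockA i 0 M * blockA 0 j N + blockA i 1 M * blockA 1 j N := by
  ext s s'
  simp [blockA, mul_apply, Fintype.sum_prod_type, Fin.sum_univ_two]

theorem blockA_conjTranspose (i j : Fin 2) (M : Matrix ThreeQubits ThreeQubits ℂ) :
    blockA i j Mᴴ = (blockA j i M)ᴴ := rfl

theorem ext_blockA {M N : Matrix ThreeQubits ThreeQubits ℂ}
    (h : ∀ i j, blockA i j M = blockA i j N) : M = N := by
  ext ⟨i, s⟩ ⟨j, s'⟩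
  exact congrFun (congrFun (h i j) s) s'

theorem blockA_onBC (i j : Fin 2) (U : Matrix TwoQubits TwoQubits ℂ) :
    blockA i j (onBC U) = if i = j then U else 0 := by
  ext s s'
  split_ifs with h <;> simp [blockA, onBC, one_apply, h]

theorem blockA_onAB (i j : Fin 2) (U : Matrix TwoQubits TwoQubits ℂ) :
    blockA i j (onAB U) = blockDiagonal fun _ : Fin 2 => qubitBlock i j U := by
  ext s s'
  simp [blockA, onAB, one_apply, qubitBlock, blockDiagonal_apply]

theorem blockA_diagonal (i j : Fin 2) (g : ThreeQubits → ℂ) :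
    blockA i j (diagonal g) = if i = j then diagonal (fun s => g (i, s)) else 0 := by
  ext s s'
  split_ifs with h
  · subst h; simp [blockA, diagonal_apply]
  · simp [blockA, h]

theorem onBC_mul (U V : Matrix TwoQubits TwoQubits ℂ) : onBC (U * V) = onBC U * onBC V := by
  apply ext_blockA
  intro i j
  rw [blockA_mul]
  simp only [blockA_onBC]
  fin_cases i <;> fin_cases j <;> simp

theorem onAB_mul (U V : Matrix TwoQubits TwoQubits ℂ) : onAB (U * V) = onAB U * onAB V := by
  apply ext_blockA
  intro i j
  rw [blockA_mul]
  simp only [blockA_onAB, ← blockDiagonal_mul, ← blockDiagonal_add]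
  congr 1
  ext1 r
  exact qubitBlock_mul ..

theorem onAC_mul (U V : Matrix TwoQubits TwoQubits ℂ) : onAC (U * V) = onAC U * onAC V := by
  ext ⟨a, b, c⟩ ⟨a', b', c'⟩
  by_cases h : b = b'
  · subst h
    fin_cases b <;> simp [onAC, mul_apply, Fintype.sum_prod_type, Fin.sum_univ_two]
  · fin_cases b <;> fin_cases b' <;> first | exact absurd rfl h |
      simp [onAC, mul_apply, Fintype.sum_prod_type, Fin.sum_univ_two]

theorem onBC_one : onBC 1 = 1 := by
  ext ⟨a, b, c⟩ ⟨a', b', c'⟩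
  simp only [onBC, of_apply, one_apply, Prod.mk.injEq]
  split_ifs <;> simp_all

theorem onAC_one : onAC 1 = 1 := by
  ext ⟨a, b, c⟩ ⟨a', b', c'⟩
  simp only [onAC, of_apply, one_apply, Prod.mk.injEq]
  split_ifs <;> simp_all

theorem onAB_one : onAB 1 = 1 := by
  ext ⟨a, b, c⟩ ⟨a', b', c'⟩
  simp only [onAB, of_apply, one_apply, Prod.mk.injEq]
  split_ifs <;> simp_all

theorem onBC_conjTranspose (U : Matrix TwoQubits TwoQubits ℂ) : (onBC U)ᴴ = onBC Uᴴ := by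
  ext p q
  by_cases h : p.1 = q.1
  · simp [onBC, one_apply, h]
  · simp [onBC, h, Ne.symm h]

theorem onAC_conjTranspose (U : Matrix TwoQubits TwoQubits ℂ) : (onAC U)ᴴ = onAC Uᴴ := by
  ext p q
  by_cases h : p.2.1 = q.2.1
  · simp [onAC, one_apply, h]
  · simp [onAC, h, Ne.symm h]

theorem onAB_conjTranspose (U : Matrix TwoQubits TwoQubits ℂ) : (onAB U)ᴴ = onAB Uᴴ := by
  ext p q
  by_cases h : p.2.2 = q.2.2
  · simp [onAB, one_apply, h]
  · simp [onAB, h, Ne.symm h]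

theorem onBC_injective : Function.Injective onBC := by
  intro U V h
  have := congrArg (blockA 0 0) h
  simpa [blockA_onBC] using this

theorem onAC_injective : Function.Injective onAC := by
  intro U V h
  ext ⟨a, c⟩ ⟨a', c'⟩
  have := congrFun (congrFun h (a, 0, c)) (a', 0, c')
  simpa [onAC] using this

theorem onAB_injective : Function.Injective onAB := by
  intro U V h
  ext ⟨a, b⟩ ⟨a', b'⟩
  have := congrFun (congrFun h (a, b, 0)) (a', b', 0)
  simpa [onAB] using this

/-- The operator `U` on the two qubits other than the qubit `k` (in the order of `ABC`). -/
def offQubit : Fin 3 → Matrix TwoQubits TwoQubits ℂ → Matrix ThreeQubits ThreeQubits ℂ :=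
  ![onBC, onAC, onAB]

theorem offQubit_mul (k : Fin 3) (U V : Matrix TwoQubits TwoQubits ℂ) :
    offQubit k (U * V) = offQubit k U * offQubit k V := by
  fin_cases k
  exacts [onBC_mul U V, onAC_mul U V, onAB_mul U V]

theorem offQubit_one (k : Fin 3) : offQubit k 1 = 1 := by
  fin_cases k
  exacts [onBC_one, onAC_one, onAB_one]

theorem offQubit_conjTranspose (k : Fin 3) (U : Matrix TwoQubits TwoQubits ℂ) :
    (offQubit k U)ᴴ = offQubit k Uᴴ := by
  fin_cases k
  exacts [onBC_conjTranspose U, onAC_conjTranspose U, onAB_conjTranspose U]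

theorem offQubit_injective (k : Fin 3) : Function.Injective (offQubit k) := by
  fin_cases k
  exacts [onBC_injective, onAC_injective, onAB_injective]

theorem offQubit_transpose (k : Fin 3) (U : Matrix TwoQubits TwoQubits ℂ) :
    (offQubit k U)ᵀ = offQubit k Uᵀ := by
  have h : ∀ i j : Fin 2, (1 : Matrix (Fin 2) (Fin 2) ℂ) i j = (1 : Matrix (Fin 2) (Fin 2) ℂ) j i :=
    fun i j => by simp only [one_apply, eq_comm]
  ext p q
  fin_cases k
  · exact congrArg (U q.2 p.2 * ·) (h q.1 p.1)
  · exact congrArg (U (q.1, q.2.2) (p.1, p.2.2) * ·) (h q.2.1 p.2.1)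
  · exact congrArg (U (q.1, q.2.1) (p.1, p.2.1) * ·) (h q.2.2 p.2.2)

theorem offQubit_mem_unitaryGroup_iff (k : Fin 3) (U : Matrix TwoQubits TwoQubits ℂ) :
    offQubit k U ∈ unitaryGroup ThreeQubits ℂ ↔ U ∈ unitaryGroup TwoQubits ℂ := by
  rw [mem_unitaryGroup_iff', mem_unitaryGroup_iff', star_eq_conjTranspose, star_eq_conjTranspose,
    offQubit_conjTranspose, ← offQubit_mul, ← offQubit_one k, (offQubit_injective k).eq_iff]

/-- A two-qubit gate which acts trivially on the qubit `k`. -/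
def IsGateOff (k : Fin 3) (G : Matrix ThreeQubits ThreeQubits ℂ) : Prop :=
  ∃ U ∈ unitaryGroup TwoQubits ℂ, G = offQubit k U

theorem IsTwoQubitGate.exists_isGateOff {G : Matrix ThreeQubits ThreeQubits ℂ}
    (h : IsTwoQubitGate G) : ∃ k, IsGateOff k G := by
  obtain ⟨U, hU, h | h | h⟩ := h
  exacts [⟨2, U, hU, h⟩, ⟨1, U, hU, h⟩, ⟨0, U, hU, h⟩]

namespace IsGateOff

variable {k : Fin 3} {G H : Matrix ThreeQubits ThreeQubits ℂ}

theorem one (k : Fin 3) : IsGateOff k 1 := ⟨1, one_mem _, (offQubit_one k).symm⟩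

theorem mul (hG : IsGateOff k G) (hH : IsGateOff k H) : IsGateOff k (G * H) := by
  obtain ⟨U, hU, rfl⟩ := hG
  obtain ⟨V, hV, rfl⟩ := hH
  exact ⟨U * V, mul_mem hU hV, (offQubit_mul k U V).symm⟩

/-- Transposition reverses a circuit while fixing its diagonal product, so patterns need only be
treated up to reversal. -/
theorem transpose (hG : IsGateOff k G) : IsGateOff k Gᵀ := by
  obtain ⟨U, hU, rfl⟩ := hG
  refine ⟨Uᵀ, ?_, offQubit_transpose k U⟩
  rw [mem_unitaryGroup_iff] at hU
  rw [mem_unitaryGroup_iff']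
  change (star U)ᵀ * Uᵀ = 1
  rw [← transpose_mul, hU, transpose_one]

theorem mem_unitaryGroup (hG : IsGateOff k G) : G ∈ unitaryGroup ThreeQubits ℂ := by
  obtain ⟨U, hU, rfl⟩ := hG
  exact (offQubit_mem_unitaryGroup_iff k U).2 hU

end IsGateOff

/-! ### Permuting the qubits -/

/-- The value of the qubit `k` in the basis state `p`. -/
def qubit (k : Fin 3) (p : ThreeQubits) : Fin 2 := ![p.1, p.2.1, p.2.2] k

/-- The basis state in which the qubits `x`, `y` and the remaining one have the values `p`. -/
def relabel (x y : Fin 3) (p : ThreeQubits) : ThreeQubits :=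
  let f : Fin 3 → Fin 2 := fun k => if k = x then p.1 else if k = y then p.2.1 else p.2.2
  (f 0, f 1, f 2)

theorem relabel_bijective {x y : Fin 3} (h : x ≠ y) : Function.Bijective (relabel x y) := by
  revert x y
  unfold Function.Bijective Function.Injective Function.Surjective
  decide

theorem qubit_relabel (k x y : Fin 3) (p : ThreeQubits) :
    qubit k (relabel x y p) = if k = x then p.1 else if k = y then p.2.1 else p.2.2 := by
  fin_cases k <;> rfl

/-- The relabelling of the qubits `x`, `y` and the remaining one as `A`, `B`, `C`. -/
noncomputable def relabelEquiv {x y : Fin 3} (h : x ≠ y) : ThreeQubits ≃ ThreeQubits :=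
  Equiv.ofBijective (relabel x y) (relabel_bijective h)

/-- Entrywise form of the statement that an operator acts trivially on the qubit `k`. -/
def IsTrivialOn (k : Fin 3) (M : Matrix ThreeQubits ThreeQubits ℂ) : Prop :=
  (∀ p q, qubit k p ≠ qubit k q → M p q = 0) ∧
    ∀ p q p' q', qubit k p = qubit k q → qubit k p' = qubit k q' →
      (∀ j ≠ k, qubit j p = qubit j p') → (∀ j ≠ k, qubit j q = qubit j q') → M p q = M p' q'

theorem isTrivialOn_offQubit (k : Fin 3) (U : Matrix TwoQubits TwoQubits ℂ) :
    IsTrivialOn k (offQubit k U) := by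
  constructor
  · intro p q h
    fin_cases k
    · have h' : p.1 ≠ q.1 := h
      change onBC U p q = 0
      simp [onBC, h']
    · have h' : p.2.1 ≠ q.2.1 := h
      change onAC U p q = 0
      simp [onAC, h']
    · have h' : p.2.2 ≠ q.2.2 := h
      change onAB U p q = 0
      simp [onAB, h']
  · rintro ⟨a, b, c⟩ ⟨d, e, f⟩ ⟨a', b', c'⟩ ⟨d', e', f'⟩ h h' hp hq
    fin_cases k
    · obtain rfl : b = b' := hp 1 (by decide)
      obtain rfl : c = c' := hp 2 (by decide)
      obtain rfl : e = e' := hq 1 (by decide)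
      obtain rfl : f = f' := hq 2 (by decide)
      obtain rfl : a = d := h
      obtain rfl : a' = d' := h'
      change onBC U _ _ = onBC U _ _
      simp [onBC]
    · obtain rfl : a = a' := hp 0 (by decide)
      obtain rfl : c = c' := hp 2 (by decide)
      obtain rfl : d = d' := hq 0 (by decide)
      obtain rfl : f = f' := hq 2 (by decide)
      obtain rfl : b = e := h
      obtain rfl : b' = e' := h'
      change onAC U _ _ = onAC U _ _
      simp [onAC]
    · obtain rfl : a = a' := hp 0 (by decide)
      obtain rfl : b = b' := hp 1 (by decide)
      obtain rfl : d = d' := hq 0 (by decide)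
      obtain rfl : e = e' := hq 1 (by decide)
      obtain rfl : c = f := h
      obtain rfl : c' = f' := h'
      change onAB U _ _ = onAB U _ _
      simp [onAB]

theorem IsTrivialOn.exists_eq_offQubit {k : Fin 3} {M : Matrix ThreeQubits ThreeQubits ℂ}
    (h : IsTrivialOn k M) : ∃ U, M = offQubit k U := by
  have key : ∀ (U : Matrix TwoQubits TwoQubits ℂ), (∀ p q, qubit k p = 0 → qubit k q = 0 →
      M p q = offQubit k U p q) → M = offQubit k U := by
    intro U hU
    have hex : ∀ p : ThreeQubits, ∃ p' : ThreeQubits, qubit k p' = 0 ∧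
        ∀ j ≠ k, qubit j p = qubit j p' := by
      fin_cases k <;> rintro ⟨a, b, c⟩
      · exact ⟨(0, b, c), rfl, fun j hj => by fin_cases j <;> first | rfl | exact absurd rfl hj⟩
      · exact ⟨(a, 0, c), rfl, fun j hj => by fin_cases j <;> first | rfl | exact absurd rfl hj⟩
      · exact ⟨(a, b, 0), rfl, fun j hj => by fin_cases j <;> first | rfl | exact absurd rfl hj⟩
    ext p q
    have hT := isTrivialOn_offQubit k U
    by_cases hpq : qubit k p = qubit k q
    · obtain ⟨p', hp', hp⟩ := hex p
      obtain ⟨q', hq', hq⟩ := hex q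
      rw [h.2 p q p' q' hpq (hp'.trans hq'.symm) hp hq, hU p' q' hp' hq',
        hT.2 p q p' q' hpq (hp'.trans hq'.symm) hp hq]
    · rw [h.1 p q hpq, hT.1 p q hpq]
  fin_cases k
  · refine ⟨of fun s t => M (0, s.1, s.2) (0, t.1, t.2), key _ ?_⟩
    rintro ⟨a, b, c⟩ ⟨a', b', c'⟩ (rfl : a = 0) (rfl : a' = 0)
    change _ = onBC _ _ _
    simp [onBC]
  · refine ⟨of fun s t => M (s.1, 0, s.2) (t.1, 0, t.2), key _ ?_⟩
    rintro ⟨a, b, c⟩ ⟨a', b', c'⟩ (rfl : b = 0) (rfl : b' = 0)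
    change _ = onAC _ _ _
    simp [onAC]
  · refine ⟨of fun s t => M (s.1, s.2, 0) (t.1, t.2, 0), key _ ?_⟩
    rintro ⟨a, b, c⟩ ⟨a', b', c'⟩ (rfl : c = 0) (rfl : c' = 0)
    change _ = onAB _ _ _
    simp [onAB]

/-- Gates on pairs remain such gates when the qubits are permuted; this reduces each circuit pattern
to one fixed placement on `A`, `B`, `C`. -/
theorem IsGateOff.submatrix {k k' : Fin 3} {M : Matrix ThreeQubits ThreeQubits ℂ}
    (hM : IsGateOff k M) (e : ThreeQubits ≃ ThreeQubits) (σ : Equiv.Perm (Fin 3))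
    (he : ∀ j p, qubit j (e p) = qubit (σ j) p) (hk : σ k = k') :
    IsGateOff k' (M.submatrix e e) := by
  have hu : M.submatrix e e ∈ unitaryGroup ThreeQubits ℂ := by
    have := hM.mem_unitaryGroup
    rw [mem_unitaryGroup_iff', star_eq_conjTranspose] at this ⊢
    rw [conjTranspose_submatrix, submatrix_mul_equiv, this, submatrix_one_equiv]
  have ht : IsTrivialOn k' (M.submatrix e e) := by
    obtain ⟨U, -, rfl⟩ := hM
    have hU := isTrivialOn_offQubit k U
    subst hk
    have hj : ∀ {p p' : ThreeQubits}, (∀ j ≠ σ k, qubit j p = qubit j p') →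
        ∀ j ≠ k, qubit j (e p) = qubit j (e p') := by
      intro p p' h j hj
      rw [he, he]
      exact h _ fun hc => hj (σ.injective hc)
    refine ⟨fun p q h => hU.1 _ _ (by rwa [he, he]), fun p q p' q' h h' hp hq =>
      hU.2 _ _ _ _ (by rwa [he, he]) (by rwa [he, he]) (hj hp) (hj hq)⟩
  obtain ⟨U, hU⟩ := ht.exists_eq_offQubit
  exact ⟨U, (offQubit_mem_unitaryGroup_iff k' U).1 (hU ▸ hu), hU⟩

theorem exists_perm_relabel {x y r : Fin 3} (hxy : x ≠ y) (hxr : x ≠ r) (hyr : y ≠ r) :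
    ∃ σ : Equiv.Perm (Fin 3), σ x = 0 ∧ σ y = 1 ∧ σ r = 2 ∧
      ∀ j p, qubit j (relabelEquiv hxy p) = qubit (σ j) p := by
  have h : ∀ x y r : Fin 3, x ≠ y → x ≠ r → y ≠ r → ∃ σ : Equiv.Perm (Fin 3), σ x = 0 ∧ σ y = 1 ∧
      σ r = 2 := by decide
  obtain ⟨σ, h0, h1, h2⟩ := h x y r hxy hxr hyr
  refine ⟨σ, h0, h1, h2, fun j p => ?_⟩
  change qubit j (relabel x y p) = _
  rw [qubit_relabel]
  split_ifs with a b
  · rw [a, h0]; rfl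
  · rw [b, h1]; rfl
  · have : j = r := by omega
    rw [this, h2]; rfl

/-! ### One-qubit algebras inside two qubits and their commutation with gates -/

/-- Representation `p ↦ p ⊗ 1` of the one-qubit operators on the first of two qubits. -/
def onFirst : Matrix (Fin 2) (Fin 2) ℂ →⋆ₐ[ℂ] Matrix TwoQubits TwoQubits ℂ where
  toFun p := p ⊗ₖ 1
  map_one' := one_kronecker_one
  map_mul' p q := by rw [← mul_kronecker_mul, one_mul]
  map_zero' := zero_kronecker _
  map_add' p q := add_kronecker ..
  commutes' c := by
    rw [Algebra.algebraMap_eq_smul_one, Algebra.algebraMap_eq_smul_one, smul_kronecker,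
      one_kronecker_one]
  map_star' p := by
    rw [star_eq_conjTranspose, star_eq_conjTranspose, conjTranspose_kronecker, conjTranspose_one]

/-- Representation `p ↦ 1 ⊗ p` of the one-qubit operators on the second of two qubits. -/
def onSecond : Matrix (Fin 2) (Fin 2) ℂ →⋆ₐ[ℂ] Matrix TwoQubits TwoQubits ℂ where
  toFun p := 1 ⊗ₖ p
  map_one' := one_kronecker_one
  map_mul' p q := by rw [← mul_kronecker_mul, one_mul]
  map_zero' := kronecker_zero _
  map_add' p q := kronecker_add ..
  commutes' c := by
    rw [Algebra.algebraMap_eq_smul_one, Algebra.algebraMap_eq_smul_one, kronecker_smul,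
      one_kronecker_one]
  map_star' p := by
    rw [star_eq_conjTranspose, star_eq_conjTranspose, conjTranspose_kronecker, conjTranspose_one]

/-- The representation `φ` conjugated by a unitary. -/
def conjRep (φ : Matrix (Fin 2) (Fin 2) ℂ →⋆ₐ[ℂ] Matrix TwoQubits TwoQubits ℂ)
    {X : Matrix TwoQubits TwoQubits ℂ} (hX : Xᴴ * X = 1) :
    Matrix (Fin 2) (Fin 2) ℂ →⋆ₐ[ℂ] Matrix TwoQubits TwoQubits ℂ where
  toFun p := Xᴴ * φ p * X
  map_one' := by rw [map_one, mul_one, hX]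
  map_mul' p q := by
    rw [map_mul]
    calc _ = Xᴴ * φ p * 1 * φ q * X := by simp only [mul_assoc, one_mul]
      _ = _ := by rw [← mul_eq_one_comm.1 hX]; simp only [mul_assoc]
  map_zero' := by rw [map_zero, mul_zero, zero_mul]
  map_add' p q := by rw [map_add, mul_add, add_mul]
  commutes' c := by
    rw [AlgHomClass.commutes, Algebra.algebraMap_eq_smul_one, mul_smul_comm, mul_one,
      smul_mul_assoc, hX]
  map_star' p := by
    rw [map_star]
    simp only [star_eq_conjTranspose, conjTranspose_mul, conjTranspose_conjTranspose, mul_assoc]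

theorem onBC_mul_onAB_onFirst_comm (U : Matrix TwoQubits TwoQubits ℂ)
    (p : Matrix (Fin 2) (Fin 2) ℂ) : onBC U * onAB (onFirst p) = onAB (onFirst p) * onBC U := by
  have h : ∀ i j, qubitBlock i j (onFirst p) = p i j • 1 := by
    intro i j
    ext y y'
    simp [qubitBlock, onFirst, kroneckerMap_apply]
  have hd : ∀ c : ℂ, blockDiagonal (fun _ : Fin 2 => c • (1 : Matrix (Fin 2) (Fin 2) ℂ)) =
      c • (1 : Matrix TwoQubits TwoQubits ℂ) := by
    intro c
    rw [← blockDiagonal_one, ← blockDiagonal_smul]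
    rfl
  apply ext_blockA
  intro i j
  rw [blockA_mul, blockA_mul]
  simp only [blockA_onBC, blockA_onAB, h, hd]
  fin_cases i <;> fin_cases j <;> simp

theorem onAC_mul_onAB_onSecond_comm (U : Matrix TwoQubits TwoQubits ℂ)
    (p : Matrix (Fin 2) (Fin 2) ℂ) : onAC U * onAB (onSecond p) = onAB (onSecond p) * onAC U := by
  ext ⟨a, b, c⟩ ⟨a', b', c'⟩
  have e1 : (onAC U * onAB (onSecond p)) (a, b, c) (a', b', c') = U (a, c) (a', c') * p b b' := by
    rw [mul_apply, Finset.sum_eq_single (a', b, c')]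
    · simp [onAC, onAB, onSecond, kroneckerMap_apply]
    · rintro ⟨x, y, z⟩ - hne
      by_cases hy : b = y
      · by_cases hz : z = c'
        · have hx : x ≠ a' := fun hx => hne (by rw [hx, hy, hz])
          simp [onAC, onAB, onSecond, kroneckerMap_apply, hx]
        · simp [onAC, onAB, onSecond, kroneckerMap_apply, hz]
      · simp [onAC, onAB, onSecond, kroneckerMap_apply, hy]
    · simp
  have e2 : (onAB (onSecond p) * onAC U) (a, b, c) (a', b', c') = p b b' * U (a, c) (a', c') := by
    rw [mul_apply, Finset.sum_eq_single (a, b', c)]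
    · simp [onAC, onAB, onSecond, kroneckerMap_apply]
    · rintro ⟨x, y, z⟩ - hne
      by_cases hy : y = b'
      · by_cases hz : c = z
        · have hx : a ≠ x := fun hx => hne (by rw [hx, hy, hz])
          simp [onAC, onAB, onSecond, kroneckerMap_apply, hx]
        · simp [onAC, onAB, onSecond, kroneckerMap_apply, hz]
      · simp [onAC, onAB, onSecond, kroneckerMap_apply, hy]
    · simp
  rw [e1, e2, mul_comm]

/-! ### Alternating circuits -/

theorem diagonal_pair_eq_blockDiagonal (f : TwoQubits → ℂ) :
    diagonal f = blockDiagonal fun r => diagonal fun y => f (y, r) := by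
  ext ⟨y, r⟩ ⟨y', r'⟩
  by_cases hr : r = r'
  · subst hr
    by_cases hy : y = y' <;> simp [blockDiagonal_apply, hy]
  · simp [blockDiagonal_apply, hr]

/-- The relative phases `D_r(y) = g(1, y, r) / g(0, y, r)` of a diagonal unitary with respect to
the qubit `A`. -/
def relPhase (g : ThreeQubits → ℂ) (r y : Fin 2) : ℂ := g (1, y, r) * star (g (0, y, r))

/-- With respect to `A` the conjugating operator is block diagonal with blocks `D i * K`. Dividing
the `0 1` block by `D 1 * (D 0)ᴴ` exposes the relative phases and shows the off-diagonal blocks of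
`φ` to be singular. The second alternative of `h2` serves circuits of three gates, where `K` is
absent. -/
theorem false_of_conj_onAB (φ : Matrix (Fin 2) (Fin 2) ℂ →⋆ₐ[ℂ] Matrix TwoQubits TwoQubits ℂ)
    {K : Matrix TwoQubits TwoQubits ℂ} (hK : Kᴴ * K = 1) {g : ThreeQubits → ℂ}
    (hg : ∀ p, g p * star (g p) = 1)
    (h : ∀ p, ∃ R, diagonal g * onBC K * onAB (φ p) * (diagonal g * onBC K)ᴴ = onAB R)
    (h1 : relPhase g 0 0 * relPhase g 1 1 ≠ relPhase g 0 1 * relPhase g 1 0)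
    (h2 : relPhase g 0 0 * relPhase g 0 1 ≠ relPhase g 1 0 * relPhase g 1 1 ∨
      (K = 1 ∧ ∀ s, g (0, s) = 1)) : False := by
  have hg' : ∀ p, star (g p) * g p = 1 := fun p => by rw [mul_comm, hg]
  let D : Fin 2 → Matrix TwoQubits TwoQubits ℂ := fun i => diagonal fun s => g (i, s)
  have hD : ∀ i, (D i)ᴴ * D i = 1 := by
    intro i
    simp only [D, diagonal_conjTranspose, diagonal_mul_diagonal, Pi.star_apply, hg', diagonal_one]
  have hbl : ∀ p, ∃ R, ∀ i j, D i * K * blockDiagonal (fun _ : Fin 2 => qubitBlock i j (φ p)) *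
      (D j * K)ᴴ = blockDiagonal fun _ : Fin 2 => qubitBlock i j R := by
    intro p
    obtain ⟨R, hR⟩ := h p
    refine ⟨R, fun i j => ?_⟩
    rw [← blockA_onAB, ← blockA_onAB, ← hR]
    have e : ∀ i j, blockA i j (diagonal g * onBC K) = if i = j then D i * K else 0 := by
      intro i j
      rw [blockA_mul]
      simp only [blockA_onBC, blockA_diagonal]
      fin_cases i <;> fin_cases j <;> simp [D]
    generalize diagonal g * onBC K = P at *
    rw [blockA_mul, blockA_mul, blockA_mul]
    simp only [blockA_conjTranspose, e]
    fin_cases i <;> fin_cases j <;> simp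
  have hrel : D 1 * (D 0)ᴴ = blockDiagonal fun r => diagonal (relPhase g r) := by
    simp only [D, diagonal_conjTranspose, diagonal_mul_diagonal]
    rw [diagonal_pair_eq_blockDiagonal]
    rfl
  have hK0 : (D 0 * K)ᴴ * (D 0 * K) = 1 := by
    rw [conjTranspose_mul, mul_assoc, ← mul_assoc _ (D 0), hD, one_mul, hK]
  have hrp : ∀ r y, relPhase g r y * star (relPhase g r y) = 1 := by
    intro r y
    rw [relPhase, star_mul, star_star]
    linear_combination (g (0, y, r) * star (g (0, y, r))) * hg (1, y, r) + hg (0, y, r)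
  refine false_of_singular_blocks φ hK0 hrp ?_ ?_ ?_ h1
  · intro p
    obtain ⟨R, hR⟩ := hbl p
    exact ⟨_, hR 0 0⟩
  · intro p
    obtain ⟨R, hR⟩ := hbl p
    have hR' := hR 0 1
    have e : D 0 * K * blockDiagonal (fun _ : Fin 2 => qubitBlock 0 1 (φ p)) * (D 0 * K)ᴴ =
        blockDiagonal fun r => qubitBlock 0 1 R * diagonal (relPhase g r) := by
      have := congrArg (· * (D 1 * (D 0)ᴴ)) hR'
      rw [hrel, ← blockDiagonal_mul, ← hrel] at this
      rw [← this]
      rw [conjTranspose_mul, conjTranspose_mul]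
      calc _ = D 0 * K * blockDiagonal (fun _ : Fin 2 => qubitBlock 0 1 (φ p)) *
            (Kᴴ * ((D 1)ᴴ * D 1) * (D 0)ᴴ) := by rw [hD, mul_one]
        _ = _ := by simp only [mul_assoc]
    rcases h2 with h2 | ⟨rfl, h2⟩
    · exact det_eq_zero_of_blockDiagonal_conj hK0 e h1 h2
    · have hD0 : D 0 = 1 := by simp only [D, h2, diagonal_one]
      rw [hD0, mul_one, one_mul, conjTranspose_one, mul_one] at e
      exact det_eq_zero_of_mul_diagonal_eq (congrFun (blockDiagonal_injective e)) h1
  · intro p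
    obtain ⟨R, hR⟩ := hbl p
    refine ⟨qubitBlock 1 1 R, ?_⟩
    rw [← hR 1 1, ← hrel]
    simp only [conjTranspose_mul, conjTranspose_conjTranspose]
    calc _ = D 1 * ((D 0)ᴴ * D 0) * K * blockDiagonal (fun _ : Fin 2 => qubitBlock 1 1 (φ p)) *
          Kᴴ * ((D 0)ᴴ * D 0) * (D 1)ᴴ := by simp only [mul_assoc]
      _ = _ := by rw [hD, mul_one, mul_one]; simp only [mul_assoc]

/-- Circuits `X₁ Y X₂ Z` in which the `X`s act trivially on the qubit `r`, `Z` acts trivially on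
the qubit `x`, and `Y` acts trivially on another qubit than `r`. -/
theorem false_of_alternating {x y r q : Fin 3} (hxy : x ≠ y) (hxr : x ≠ r) (hyr : y ≠ r)
    (hq : q ≠ r) {X₁ Y X₂ Z : Matrix ThreeQubits ThreeQubits ℂ} (hX₁ : IsGateOff r X₁)
    (hY : IsGateOff q Y) (hX₂ : IsGateOff r X₂) (hZ : IsGateOff x Z) {g : ThreeQubits → ℂ}
    (hg : ∀ p, g p * star (g p) = 1) (hprod : X₁ * Y * X₂ * Z = diagonal g)
    (h1 : relPhase (g ∘ relabel x y) 0 0 * relPhase (g ∘ relabel x y) 1 1 ≠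
      relPhase (g ∘ relabel x y) 0 1 * relPhase (g ∘ relabel x y) 1 0)
    (h2 : relPhase (g ∘ relabel x y) 0 0 * relPhase (g ∘ relabel x y) 0 1 ≠
        relPhase (g ∘ relabel x y) 1 0 * relPhase (g ∘ relabel x y) 1 1 ∨
      (Z = 1 ∧ ∀ s, g (relabel x y (0, s)) = 1)) : False := by
  obtain ⟨σ, hσx, hσy, hσr, he⟩ := exists_perm_relabel hxy hxr hyr
  set e := relabelEquiv hxy
  replace hX₁ := hX₁.submatrix e σ he hσr
  replace hX₂ := hX₂.submatrix e σ he hσr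
  replace hY := hY.submatrix e σ he rfl
  have hZ' := hZ.submatrix e σ he hσx
  have hq' : σ q ≠ 2 := fun hc => hq (σ.injective (hc.trans hσr.symm))
  have hprod' := congrArg (fun M => M.submatrix e e) hprod
  rw [← submatrix_mul_equiv _ _ _ e, ← submatrix_mul_equiv _ _ _ e, ← submatrix_mul_equiv _ _ _ e,
    submatrix_diagonal_equiv] at hprod'
  have hge : g ∘ e = g ∘ relabel x y := rfl
  obtain ⟨U₁, hU₁, e₁⟩ := hX₁
  obtain ⟨U₂, hU₂, e₂⟩ := hX₂
  obtain ⟨W, hW, eZ⟩ := hZ'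
  rw [mem_unitaryGroup_iff', star_eq_conjTranspose] at hU₁ hU₂ hW
  have hYu : Y.submatrix e e * (Y.submatrix e e)ᴴ = 1 := mem_unitaryGroup_iff.1 hY.mem_unitaryGroup
  -- `Y` ignores one of the qubits `A`, `B`; `ι` is the algebra of operators on that qubit, seen
  -- inside `AB`.
  obtain ⟨ι, hι⟩ : ∃ ι : Matrix (Fin 2) (Fin 2) ℂ →⋆ₐ[ℂ] Matrix TwoQubits TwoQubits ℂ,
      ∀ p, Y.submatrix e e * onAB (ι p) = onAB (ι p) * Y.submatrix e e := by
    have : σ q = 0 ∨ σ q = 1 := by omega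
    obtain ⟨U, -, hU⟩ := hY
    rcases this with h | h <;> rw [h] at hU <;> rw [hU]
    · exact ⟨onFirst, onBC_mul_onAB_onFirst_comm U⟩
    · exact ⟨onSecond, onAC_mul_onAB_onSecond_comm U⟩
  generalize Y.submatrix e e = Y' at *
  change X₁.submatrix e e = onAB U₁ at e₁
  change X₂.submatrix e e = onAB U₂ at e₂
  change Z.submatrix e e = onBC W at eZ
  rw [e₁, e₂, eZ, hge] at hprod'
  have hWW : onBC W * onBC Wᴴ = 1 := by rw [← onBC_mul, mul_eq_one_comm.1 hW, onBC_one]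
  have hUU : onAB U₂ * onAB U₂ᴴ = 1 := by rw [← onAB_mul, mul_eq_one_comm.1 hU₂, onAB_one]
  refine false_of_conj_onAB (conjRep ι hU₂) (K := Wᴴ) (g := g ∘ relabel x y) ?_ (fun p => hg _)
    ?_ h1 ?_
  · rw [conjTranspose_conjTranspose, mul_eq_one_comm.1 hW]
  · intro p
    refine ⟨U₁ * ι p * U₁ᴴ, ?_⟩
    have hH : diagonal (g ∘ relabel x y) * onBC Wᴴ = onAB U₁ * Y' * onAB U₂ := by
      rw [← hprod', mul_assoc, hWW, mul_one]
    rw [hH]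
    change _ * onAB (U₂ᴴ * ι p * U₂) * _ = _
    simp only [onAB_mul, conjTranspose_mul, ← onAB_conjTranspose]
    rw [← onAB_conjTranspose] at hUU
    calc _ = onAB U₁ * Y' * (onAB U₂ * (onAB U₂)ᴴ) * onAB (ι p) * (onAB U₂ * (onAB U₂)ᴴ) * Y'ᴴ *
          (onAB U₁)ᴴ := by simp only [mul_assoc]
      _ = onAB U₁ * (Y' * onAB (ι p)) * Y'ᴴ * (onAB U₁)ᴴ := by
          rw [hUU]; simp only [mul_assoc, one_mul]
      _ = onAB U₁ * onAB (ι p) * (Y' * Y'ᴴ) * (onAB U₁)ᴴ := by rw [hι]; simp only [mul_assoc]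
      _ = _ := by rw [hYu, mul_one]
  · refine h2.imp_right fun ⟨hZ1, h⟩ => ⟨?_, h⟩
    rw [hZ1, submatrix_one_equiv, ← onBC_one] at eZ
    rw [← onBC_injective eZ, conjTranspose_one]

/-! ### Cyclic circuits -/

/-- The `c`-`c'` block of a three-qubit operator with respect to the qubit `C`. -/
def blockC (c c' : Fin 2) (M : Matrix ThreeQubits ThreeQubits ℂ) : Matrix TwoQubits TwoQubits ℂ :=
  M.submatrix (fun s => (s.1, s.2, c)) fun s => (s.1, s.2, c')

theorem blockC_mul (c c' : Fin 2) (M N : Matrix ThreeQubits ThreeQubits ℂ) :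
    blockC c c' (M * N) = blockC c 0 M * blockC 0 c' N + blockC c 1 M * blockC 1 c' N := by
  ext s s'
  simp only [blockC, submatrix_apply, mul_apply, Fintype.sum_prod_type, Fin.sum_univ_two,
    Matrix.add_apply]
  ring

theorem blockC_conjTranspose (c c' : Fin 2) (M : Matrix ThreeQubits ThreeQubits ℂ) :
    blockC c c' Mᴴ = (blockC c' c M)ᴴ := rfl

theorem blockC_onAB (c c' : Fin 2) (U : Matrix TwoQubits TwoQubits ℂ) :
    blockC c c' (onAB U) = if c = c' then U else 0 := by
  ext s s'
  split_ifs with h <;> simp [blockC, onAB, one_apply, h]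

theorem blockC_diagonal (c c' : Fin 2) (g : ThreeQubits → ℂ) :
    blockC c c' (diagonal g) = if c = c' then diagonal (fun s => g (s.1, s.2, c)) else 0 := by
  ext ⟨a, b⟩ ⟨a', b'⟩
  split_ifs with h
  · subst h; simp [blockC, diagonal_apply]
  · simp [blockC, h]

theorem blockC_onBC (c c' : Fin 2) (U : Matrix TwoQubits TwoQubits ℂ) :
    blockC c c' (onBC U) = onSecond (of fun b b' => U (b, c) (b', c')) := by
  ext s s'
  simp only [blockC, onBC, onSecond, submatrix_apply, of_apply]
  exact mul_comm _ _

theorem onAB_onSecond (p : Matrix (Fin 2) (Fin 2) ℂ) : onAB (onSecond p) = onBC (onFirst p) := by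
  ext s s'
  change (1 : Matrix (Fin 2) (Fin 2) ℂ) s.1 s'.1 * p s.2.1 s'.2.1 *
      (1 : Matrix (Fin 2) (Fin 2) ℂ) s.2.2 s'.2.2 =
    p s.2.1 s'.2.1 * (1 : Matrix (Fin 2) (Fin 2) ℂ) s.2.2 s'.2.2 *
      (1 : Matrix (Fin 2) (Fin 2) ℂ) s.1 s'.1
  ring

theorem qubitBlock_onSecond_self (i : Fin 2) (p : Matrix (Fin 2) (Fin 2) ℂ) :
    qubitBlock i i (onSecond p) = p := by
  ext y y'
  simp [qubitBlock, onSecond, kroneckerMap_apply]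

/-- A representation with values in `1 ⊗ M₂` is `1 ⊗ a` for an algebra endomorphism `a`. -/
theorem exists_algHom_of_eq_onSecond
    (ψ : Matrix (Fin 2) (Fin 2) ℂ →⋆ₐ[ℂ] Matrix TwoQubits TwoQubits ℂ)
    (h : ∀ p, ∃ α, ψ p = onSecond α) :
    ∃ a : Matrix (Fin 2) (Fin 2) ℂ →ₐ[ℂ] Matrix (Fin 2) (Fin 2) ℂ, ∀ p, ψ p = onSecond (a p) := by
  have h' : ∀ p, ψ p = onSecond (qubitBlock 0 0 (ψ p)) := by
    intro p
    obtain ⟨α, hα⟩ := h p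
    rw [hα, qubitBlock_onSecond_self]
  refine ⟨{ toFun := fun p => qubitBlock 0 0 (ψ p)
            map_one' := by rw [map_one, qubitBlock_one_self]
            map_mul' := fun p q => by
              rw [map_mul, h' p, h' q, ← map_mul, qubitBlock_onSecond_self,
                qubitBlock_onSecond_self, qubitBlock_onSecond_self]
            map_zero' := by rw [map_zero]; rfl
            map_add' := fun p q => by rw [map_add]; rfl
            commutes' := fun c => by rw [AlgHomClass.commutes, qubitBlock_algebraMap_self] }, h'⟩

/-- If a circuit `X₁ Y Z X₂` with gates on `AB`, `BC`, `AC`, `AB` is diagonal, then its relative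
phase between the values of `C` normalizes the algebra of the operators on `B` conjugated by
`X₂`. -/
theorem exists_algHom_diagonal_mul {U₁ U₂ V W : Matrix TwoQubits TwoQubits ℂ} (hU₁ : U₁ᴴ * U₁ = 1)
    (hU₂ : U₂ᴴ * U₂ = 1) (hW : Wᴴ * W = 1) {g : ThreeQubits → ℂ}
    (hg : ∀ p, g p * star (g p) = 1)
    (hprod : onAB U₁ * onBC V * onAC W * onAB U₂ = diagonal g) :
    ∃ θ : Matrix (Fin 2) (Fin 2) ℂ →ₐ[ℂ] Matrix (Fin 2) (Fin 2) ℂ, ∀ p,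
      diagonal (fun s : TwoQubits => g (s.1, s.2, 1) * star (g (s.1, s.2, 0))) *
        conjRep onSecond hU₂ p = conjRep onSecond hU₂ (θ p) *
          diagonal (fun s : TwoQubits => g (s.1, s.2, 1) * star (g (s.1, s.2, 0))) := by
  have hU₁' := mul_eq_one_comm.1 hU₁
  let D : Fin 2 → Matrix TwoQubits TwoQubits ℂ := fun c => diagonal fun s => g (s.1, s.2, c)
  have hD : ∀ i, D i * (D i)ᴴ = 1 := by
    intro i
    simp only [D, diagonal_conjTranspose, diagonal_mul_diagonal, Pi.star_apply, hg, diagonal_one]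
  have hD' : ∀ i, (D i)ᴴ * D i = 1 := fun i => mul_eq_one_comm.1 (hD i)
  have hX : ∀ c, ((D c)ᴴ * U₁)ᴴ * ((D c)ᴴ * U₁) = 1 := by
    intro c
    rw [conjTranspose_mul, conjTranspose_conjTranspose, mul_assoc, ← mul_assoc (D c), hD, one_mul,
      hU₁]
  -- Seen through the circuit, the conjugated algebra on `B` passes `W` on `AC` unchanged and is
  -- then conjugated by `V` on `BC`. So after undoing `U₁` its blocks with respect to `C` are
  -- trivial on `A`.
  have hψ : ∀ c, ∃ a : Matrix (Fin 2) (Fin 2) ℂ →ₐ[ℂ] Matrix (Fin 2) (Fin 2) ℂ,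
      ∀ p, conjRep (conjRep onSecond hU₂) (hX c) p = onSecond (a p) := by
    intro c
    refine exists_algHom_of_eq_onSecond _ fun p => ?_
    have hWW : onAC W * (onAC W)ᴴ = 1 := by
      rw [onAC_conjTranspose, ← onAC_mul, mul_eq_one_comm.1 hW, onAC_one]
    have hUU : onAB U₂ * (onAB U₂)ᴴ = 1 := by
      rw [onAB_conjTranspose, ← onAB_mul, mul_eq_one_comm.1 hU₂, onAB_one]
    have hUU1 : (onAB U₁)ᴴ * onAB U₁ = 1 := by
      rw [onAB_conjTranspose, ← onAB_mul, hU₁, onAB_one]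
    have key : onAB U₁ᴴ * diagonal g * onAB (U₂ᴴ * onSecond p * U₂) * (diagonal g)ᴴ * onAB U₁ =
        onBC (V * onFirst p * Vᴴ) := by
      rw [← hprod]
      simp only [conjTranspose_mul, onAB_mul, ← onAB_conjTranspose, onBC_mul, ← onBC_conjTranspose,
        ← onAB_onSecond]
      calc _ = ((onAB U₁)ᴴ * onAB U₁) * onBC V * onAC W * (onAB U₂ * (onAB U₂)ᴴ) *
            onAB (onSecond p) * (onAB U₂ * (onAB U₂)ᴴ) * (onAC W)ᴴ * (onBC V)ᴴ *
              ((onAB U₁)ᴴ * onAB U₁) := by simp only [mul_assoc]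
        _ = onBC V * (onAC W * onAB (onSecond p)) * (onAC W)ᴴ * (onBC V)ᴴ := by
            rw [hUU, hUU1]; simp only [mul_assoc, one_mul, mul_one]
        _ = onBC V * onAB (onSecond p) * (onAC W * (onAC W)ᴴ) * (onBC V)ᴴ := by
            rw [onAC_mul_onAB_onSecond_comm]; simp only [mul_assoc]
        _ = _ := by rw [hWW, mul_one]
    have key' := congrArg (blockC c c) key
    rw [blockC_onBC] at key'
    refine ⟨_, Eq.trans ?_ key'⟩
    rw [blockC_mul, blockC_mul, blockC_mul, blockC_mul]
    simp only [blockC_mul, blockC_conjTranspose, blockC_onAB, blockC_diagonal]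
    change ((D c)ᴴ * U₁)ᴴ * (U₂ᴴ * onSecond p * U₂) * ((D c)ᴴ * U₁) = _
    rw [conjTranspose_mul, conjTranspose_conjTranspose]
    fin_cases c <;> simp [D, mul_assoc]
  obtain ⟨a₀, ha₀⟩ := hψ 0
  obtain ⟨a₁, ha₁⟩ := hψ 1
  let e₀ := AlgEquiv.ofBijective a₀ ⟨a₀.toRingHom.injective, surjective_of_algHom a₀⟩
  -- For both values of `C` the image is all of `1 ⊗ M₂`, so the two conjugations differ by an
  -- automorphism.
  let θ : Matrix (Fin 2) (Fin 2) ℂ →ₐ[ℂ] Matrix (Fin 2) (Fin 2) ℂ := e₀.symm.toAlgHom.comp a₁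
  refine ⟨θ, fun p => ?_⟩
  obtain ⟨q, hq⟩ : ∃ q, q = θ p := ⟨_, rfl⟩
  rw [← hq]
  have hq' : a₀ q = a₁ p := by
    rw [hq]
    exact e₀.apply_symm_apply (a₁ p)
  have hrel : diagonal (fun s : TwoQubits => g (s.1, s.2, 1) * star (g (s.1, s.2, 0))) =
      (D 0)ᴴ * D 1 := by
    simp only [D, diagonal_conjTranspose, diagonal_mul_diagonal, Pi.star_apply, mul_comm]
  have h := (ha₁ p).trans ((congrArg onSecond hq').symm.trans (ha₀ q).symm)
  change ((D 1)ᴴ * U₁)ᴴ * conjRep onSecond hU₂ p * ((D 1)ᴴ * U₁) =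
    ((D 0)ᴴ * U₁)ᴴ * conjRep onSecond hU₂ q * ((D 0)ᴴ * U₁) at h
  generalize conjRep onSecond hU₂ p = P at *
  generalize conjRep onSecond hU₂ q = Q at *
  rw [hrel]
  have h' := congrArg (fun M => (D 0)ᴴ * U₁ * M * (U₁ᴴ * D 1)) h
  simp only [conjTranspose_mul, conjTranspose_conjTranspose] at h'
  calc _ = (D 0)ᴴ * (U₁ * U₁ᴴ) * D 1 * P * (D 1)ᴴ * (U₁ * U₁ᴴ) * D 1 := by
        rw [hU₁', mul_one, mul_one]
        simp only [mul_assoc, hD', mul_one]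
    _ = (D 0)ᴴ * (U₁ * U₁ᴴ) * D 0 * Q * (D 0)ᴴ * (U₁ * U₁ᴴ) * D 1 := by
        simp only [mul_assoc] at h' ⊢
        exact h'
    _ = _ := by
        rw [hU₁', mul_one, mul_one, hD', one_mul, mul_assoc]

theorem eq_smul_one_of_commute {B : Matrix (Fin 2) (Fin 2) ℂ} (h : ∀ p, B * p = p * B) :
    B = B 0 0 • 1 := by
  have h1 := h !![0, 1; 0, 0]
  have h2 := h !![0, 0; 1, 0]
  have a := congrFun (congrFun h1 0) 1
  have b := congrFun (congrFun h1 1) 1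
  have c := congrFun (congrFun h2 0) 0
  simp [mul_apply, Fin.sum_univ_two] at a b c
  ext i j
  fin_cases i <;> fin_cases j <;> simp [a, b, c]

/-- The commutant of `1 ⊗ M₂` is `M₂ ⊗ 1`, since each block commutes with `M₂` and is therefore
scalar. -/
theorem exists_eq_onFirst_of_commute {M : Matrix TwoQubits TwoQubits ℂ}
    (h : ∀ p, M * onSecond p = onSecond p * M) : ∃ c, M = onFirst c := by
  have hb : ∀ i j, qubitBlock i j M = M (i, 0) (j, 0) • 1 := by
    intro i j
    refine eq_smul_one_of_commute fun p => ?_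
    have := congrArg (qubitBlock i j) (h p)
    rw [qubitBlock_mul, qubitBlock_mul] at this
    have hoff : ∀ i j, qubitBlock i j (onSecond p) = if i = j then p else 0 := by
      intro i j
      ext y y'
      split_ifs with hij <;> simp [qubitBlock, onSecond, kroneckerMap_apply, hij]
    simp only [hoff] at this
    fin_cases i <;> fin_cases j <;> simpa using this
  refine ⟨of fun i j => M (i, 0) (j, 0), ?_⟩
  ext ⟨i, y⟩ ⟨j, y'⟩
  have := congrFun (congrFun (hb i j) y) y'
  simpa [qubitBlock, onFirst, kroneckerMap_apply] using this

/-- A `2 × 2` matrix and its adjugate have equal trace. -/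
theorem trace_inv_mul_det_fin_two {a : Matrix (Fin 2) (Fin 2) ℂ} (ha : a.det ≠ 0) :
    a⁻¹.trace * a.det = a.trace := by
  rw [inv_def, adjugate_fin_two, trace_smul, trace_fin_two, trace_fin_two, Ring.inverse_eq_inv']
  simp only [of_apply, cons_val', cons_val_zero, cons_val_one, cons_val_fin_one, smul_eq_mul]
  field_simp
  ring

/-- The spectrum of a unitary diagonal matrix normalizing a factor has the form
`{βᵢ αⱼ}`. -/
theorem diagonal_normalizer {U : Matrix TwoQubits TwoQubits ℂ} (hU : Uᴴ * U = 1)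
    {δ : TwoQubits → ℂ} (hδ : ∀ s, δ s * star (δ s) = 1)
    (θ : Matrix (Fin 2) (Fin 2) ℂ →ₐ[ℂ] Matrix (Fin 2) (Fin 2) ℂ)
    (h : ∀ p, diagonal δ * conjRep onSecond hU p = conjRep onSecond hU (θ p) * diagonal δ) :
    (δ (0, 0) * δ (1, 1) - δ (0, 1) * δ (1, 0)) * (δ (0, 0) * δ (1, 0) - δ (0, 1) * δ (1, 1)) *
      (δ (0, 0) * δ (0, 1) - δ (1, 0) * δ (1, 1)) = 0 := by
  have hU' := mul_eq_one_comm.1 hU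
  obtain ⟨a, b, hab, hba, hθ⟩ := exists_conj_of_algHom θ
  let φ := conjRep onSecond hU
  have hφ : ∀ p, U * φ p * Uᴴ = onSecond p := by
    intro p
    change U * (Uᴴ * onSecond p * U) * Uᴴ = _
    calc _ = (U * Uᴴ) * onSecond p * (U * Uᴴ) := by simp only [mul_assoc]
      _ = _ := by rw [hU', one_mul, mul_one]
  -- `θ` is conjugation by `a`; removing that inner part from `δ` leaves an element of the
  -- commutant, so `δ` becomes `c ⊗ a`.
  have hE : ∀ p, φ b * diagonal δ * φ p = φ p * (φ b * diagonal δ) := by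
    intro p
    rw [mul_assoc, h p, hθ, ← mul_assoc]
    change φ b * φ (a * p * b) * _ = _
    rw [← map_mul, ← mul_assoc, ← mul_assoc, hba, one_mul, map_mul, mul_assoc]
  obtain ⟨c, hc⟩ : ∃ c, U * (φ b * diagonal δ) * Uᴴ = onFirst c := by
    refine exists_eq_onFirst_of_commute fun p => ?_
    rw [← hφ p]
    calc _ = U * (φ b * diagonal δ) * (Uᴴ * U) * φ p * Uᴴ := by simp only [mul_assoc]
      _ = U * (φ b * diagonal δ * φ p) * Uᴴ := by rw [hU, mul_one]; simp only [mul_assoc]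
      _ = U * φ p * (Uᴴ * U) * (φ b * diagonal δ) * Uᴴ := by
          rw [hE, hU, mul_one]; simp only [mul_assoc]
      _ = _ := by simp only [mul_assoc]
  have hD : U * diagonal δ * Uᴴ = c ⊗ₖ a := by
    have e : onSecond a * onFirst c = c ⊗ₖ a := by
      change (1 ⊗ₖ a) * (c ⊗ₖ 1) = _
      rw [← mul_kronecker_mul, one_mul, mul_one]
    rw [← e, ← hc, ← hφ a]
    have hab' : φ a * φ b = 1 := by rw [← map_mul, hab, map_one]
    calc _ = U * (φ a * φ b) * diagonal δ * Uᴴ := by rw [hab', mul_one]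
      _ = U * φ a * (Uᴴ * U) * (φ b * diagonal δ) * Uᴴ := by
          rw [hU, mul_one]; simp only [mul_assoc]
      _ = _ := by simp only [mul_assoc]
  have hdd : diagonal δ * diagonal (fun s => star (δ s)) = 1 := by
    rw [diagonal_mul_diagonal, ← diagonal_one]
    exact congrArg diagonal (funext hδ)
  have hdet : (diagonal δ).det = (c.det * a.det) ^ 2 := by
    have := congrArg det hD
    rw [det_mul, det_mul, mul_right_comm, ← det_mul, hU', det_one, one_mul, det_kronecker] at this
    simpa [mul_pow] using this
  have htr : (diagonal δ).trace = c.trace * a.trace := by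
    rw [← trace_kronecker, ← hD, trace_mul_comm, ← mul_assoc, hU, one_mul]
  have hne : c.det * a.det ≠ 0 := by
    intro h0
    have := congrArg det hdd
    rw [det_mul, hdet, h0, det_one] at this
    norm_num at this
  have hc0 := left_ne_zero_of_mul hne
  have ha0 := right_ne_zero_of_mul hne
  have htr' : (diagonal fun s => star (δ s)).trace = c⁻¹.trace * a⁻¹.trace := by
    have e : U * diagonal (fun s => star (δ s)) * Uᴴ = c⁻¹ ⊗ₖ a⁻¹ := by
      have e1 : (c⁻¹ ⊗ₖ a⁻¹) * (U * diagonal δ * Uᴴ) = 1 := by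
        rw [hD, ← mul_kronecker_mul, nonsing_inv_mul _ hc0.isUnit, nonsing_inv_mul _ ha0.isUnit,
          one_kronecker_one]
      have e2 : U * diagonal δ * Uᴴ * (U * diagonal (fun s => star (δ s)) * Uᴴ) = 1 := by
        calc _ = U * diagonal δ * (Uᴴ * U) * diagonal (fun s => star (δ s)) * Uᴴ := by
              simp only [mul_assoc]
          _ = U * (diagonal δ * diagonal (fun s => star (δ s))) * Uᴴ := by
              rw [hU, mul_one]; simp only [mul_assoc]
          _ = 1 := by rw [hdd, mul_one, hU']
      exact (left_inv_eq_right_inv e1 e2).symm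
    rw [← trace_kronecker, ← e, trace_mul_comm, ← mul_assoc, hU, one_mul]
  -- This identity of traces and determinants holds for every invertible `c ⊗ a` and avoids
  -- diagonalizing the factors.
  have key : (diagonal δ).det * (diagonal fun s => star (δ s)).trace ^ 2 =
      (diagonal δ).trace ^ 2 := by
    rw [hdet, htr, htr', ← trace_inv_mul_det_fin_two hc0, ← trace_inv_mul_det_fin_two ha0]
    ring
  simp only [det_diagonal, trace_diagonal, Fintype.sum_prod_type, Fintype.prod_prod_type,
    Fin.sum_univ_two, Fin.prod_univ_two] at key
  have i00 := hδ (0, 0)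
  have i01 := hδ (0, 1)
  have i10 := hδ (1, 0)
  have i11 := hδ (1, 1)
  generalize star (δ (0, 0)) = w at *
  generalize star (δ (0, 1)) = x at *
  generalize star (δ (1, 0)) = y at *
  generalize star (δ (1, 1)) = z at *
  generalize δ (0, 0) = W at *
  generalize δ (0, 1) = X at *
  generalize δ (1, 0) = Y at *
  generalize δ (1, 1) = Z at *
  -- In elementary symmetric functions `key` says `e₃² = e₄ e₁²`, and `e₃² - e₄ e₁²` factors, up to
  -- sign, into the differences of the three pairings.
  have e3 : W * X * (Y * Z) * (w + x + (y + z)) = X * Y * Z + W * Y * Z + W * X * Z + W * X * Y := by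
    linear_combination X * Y * Z * i00 + W * Y * Z * i01 + W * X * Z * i10 + W * X * Y * i11
  have e4 : (X * Y * Z + W * Y * Z + W * X * Z + W * X * Y) ^ 2 =
      W * X * (Y * Z) * (W + X + (Y + Z)) ^ 2 := by
    rw [← key, ← e3]; ring
  linear_combination -e4

/-- The phases of `g` at `r = 1` relative to those at `r = 0`, where `r` is the qubit other than
`q` and `s`. -/
def lastRelPhase (g : ThreeQubits → ℂ) (s : TwoQubits) : ℂ :=
  g (s.1, s.2, 1) * star (g (s.1, s.2, 0))

theorem exists_algHom_of_cyclic {q s r : Fin 3} (hqs : q ≠ s) (hqr : q ≠ r) (hsr : s ≠ r)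
    {X₁ Y Z X₂ : Matrix ThreeQubits ThreeQubits ℂ} (hX₁ : IsGateOff r X₁) (hY : IsGateOff q Y)
    (hZ : IsGateOff s Z) (hX₂ : IsGateOff r X₂) {g : ThreeQubits → ℂ}
    (hg : ∀ p, g p * star (g p) = 1) (hprod : X₁ * Y * Z * X₂ = diagonal g) :
    ∃ (U : Matrix TwoQubits TwoQubits ℂ) (hU : Uᴴ * U = 1)
      (θ : Matrix (Fin 2) (Fin 2) ℂ →ₐ[ℂ] Matrix (Fin 2) (Fin 2) ℂ), (X₂ = 1 → U = 1) ∧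
      ∀ p, diagonal (lastRelPhase (g ∘ relabel q s)) * conjRep onSecond hU p =
        conjRep onSecond hU (θ p) * diagonal (lastRelPhase (g ∘ relabel q s)) := by
  obtain ⟨σ, hσq, hσs, hσr, he⟩ := exists_perm_relabel hqs hqr hsr
  set e := relabelEquiv hqs
  obtain ⟨U₁, hU₁, e₁⟩ := hX₁.submatrix e σ he hσr
  obtain ⟨U₂, hU₂, e₂⟩ := hX₂.submatrix e σ he hσr
  obtain ⟨V, hV, eY⟩ := hY.submatrix e σ he hσq
  obtain ⟨W, hW, eZ⟩ := hZ.submatrix e σ he hσs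
  have hprod' := congrArg (fun M => M.submatrix e e) hprod
  rw [← submatrix_mul_equiv _ _ _ e, ← submatrix_mul_equiv _ _ _ e, ← submatrix_mul_equiv _ _ _ e,
    submatrix_diagonal_equiv, e₁, e₂, eY, eZ] at hprod'
  rw [mem_unitaryGroup_iff', star_eq_conjTranspose] at hU₁ hU₂ hV hW
  obtain ⟨θ, hθ⟩ := exists_algHom_diagonal_mul hU₁ hU₂ hW (fun p => hg (e p)) hprod'
  refine ⟨U₂, hU₂, θ, fun h => ?_, hθ⟩
  rw [h, submatrix_one_equiv, ← offQubit_one 2] at e₂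
  exact (offQubit_injective 2 e₂).symm

/-- Without the last gate the normalized algebra is `1 ⊗ M₂` itself, and the images of a single
matrix unit already show that the ratio of the phases along the second qubit does not depend on the
first. -/
theorem mul_eq_mul_of_three_gates {q s r : Fin 3} (hqs : q ≠ s) (hqr : q ≠ r) (hsr : s ≠ r)
    {X Y Z : Matrix ThreeQubits ThreeQubits ℂ} (hX : IsGateOff r X) (hY : IsGateOff q Y)
    (hZ : IsGateOff s Z) {g : ThreeQubits → ℂ}
    (hg : ∀ p, g p * star (g p) = 1) (hprod : X * Y * Z = diagonal g) :
    lastRelPhase (g ∘ relabel q s) (0, 0) * lastRelPhase (g ∘ relabel q s) (1, 1) =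
      lastRelPhase (g ∘ relabel q s) (0, 1) * lastRelPhase (g ∘ relabel q s) (1, 0) := by
  rw [← mul_one (X * Y * Z)] at hprod
  obtain ⟨U, hU, θ, hU1, h⟩ := exists_algHom_of_cyclic hqs hqr hsr hX hY hZ (.one r) hg hprod
  obtain rfl := hU1 rfl
  have e : ∀ p, conjRep onSecond hU p = onSecond p := by
    intro p
    change 1ᴴ * onSecond p * 1 = _
    rw [conjTranspose_one, one_mul, mul_one]
  have h' := h !![0, 1; 0, 0]
  rw [e, e] at h'
  have a := congrFun (congrFun h' (0, 0)) (0, 1)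
  have b := congrFun (congrFun h' (1, 0)) (1, 1)
  rw [diagonal_mul, mul_diagonal] at a b
  change _ * ((1 : Matrix (Fin 2) (Fin 2) ℂ) 0 0 * 1) =
    (1 : Matrix (Fin 2) (Fin 2) ℂ) 0 0 * (θ _) 0 1 * _ at a
  change _ * ((1 : Matrix (Fin 2) (Fin 2) ℂ) 1 1 * 1) =
    (1 : Matrix (Fin 2) (Fin 2) ℂ) 1 1 * (θ _) 0 1 * _ at b
  rw [one_apply_eq, one_mul, one_mul, mul_one] at a b
  rw [a, b]
  ring

/-! ### Phases of the controlled-controlled gate and exclusion of short circuits -/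

/-- The diagonal entries of the controlled-controlled gate with target `diag(u, v)`. -/
def ccEntry (u v : ℂ) (p : ThreeQubits) : ℂ :=
  if p.1 = 1 ∧ p.2.1 = 1 then (if p.2.2 = 0 then u else v) else 1

theorem ccEntry_mul_star {u v : ℂ} (hu : u * star u = 1) (hv : v * star v = 1) (p : ThreeQubits) :
    ccEntry u v p * star (ccEntry u v p) = 1 := by
  unfold ccEntry
  split_ifs <;> simp_all

theorem relPhase_ccEntry_ne {u v : ℂ} (hu : u * star u = 1) (huv : u ≠ v) {x y : Fin 3}
    (hxy : x ≠ y) :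
    relPhase (ccEntry u v ∘ relabel x y) 0 0 * relPhase (ccEntry u v ∘ relabel x y) 1 1 ≠
      relPhase (ccEntry u v ∘ relabel x y) 0 1 * relPhase (ccEntry u v ∘ relabel x y) 1 0 := by
  have h : v * star u ≠ 1 := fun h => huv (by linear_combination v * hu - u * h)
  revert hxy
  fin_cases x <;> fin_cases y <;>
    simp [relPhase, ccEntry, relabel, huv.symm] <;> exact h

/-- The two determinants are `u`, `v`, or `1`, `u v`, or `1`, `v / u`, according to the roles of the
qubits. -/
theorem relPhase_ccEntry_ne' {u v : ℂ} (hu : u * star u = 1) (huv : u ≠ v) (huv1 : u * v ≠ 1)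
    {x y : Fin 3} (hxy : x ≠ y) :
    relPhase (ccEntry u v ∘ relabel x y) 0 0 * relPhase (ccEntry u v ∘ relabel x y) 0 1 ≠
      relPhase (ccEntry u v ∘ relabel x y) 1 0 * relPhase (ccEntry u v ∘ relabel x y) 1 1 := by
  have h : v * star u ≠ 1 := fun h => huv (by linear_combination v * hu - u * h)
  revert hxy
  fin_cases x <;> fin_cases y <;>
    simp [relPhase, ccEntry, relabel, huv, huv1.symm] <;> exact h.symm

/-- The phases are `1, 1, 1, v / u` if the remaining qubit is the target and `1, 1, u, v` in some
order if it is a control. The pairing here never puts `u` with `v`, so `u ≠ v` suffices; the other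
two pairings also need `u v ≠ 1`. -/
theorem lastRelPhase_ccEntry_ne {u v : ℂ} (hu : u * star u = 1) (huv : u ≠ v) {q s : Fin 3}
    (hqs : q ≠ s) :
    lastRelPhase (ccEntry u v ∘ relabel q s) (0, 0) *
        lastRelPhase (ccEntry u v ∘ relabel q s) (1, 1) ≠
      lastRelPhase (ccEntry u v ∘ relabel q s) (0, 1) *
        lastRelPhase (ccEntry u v ∘ relabel q s) (1, 0) := by
  have h : v * star u ≠ 1 := fun h => huv (by linear_combination v * hu - u * h)
  revert hqs
  fin_cases q <;> fin_cases s <;>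
    simp [lastRelPhase, ccEntry, relabel, huv.symm] <;> exact h

theorem lastRelPhase_ccEntry_ne' {u v : ℂ} (hu : u * star u = 1) (huv : u ≠ v) (huv1 : u * v ≠ 1)
    {q s : Fin 3} (hqs : q ≠ s) :
    lastRelPhase (ccEntry u v ∘ relabel q s) (0, 0) *
        lastRelPhase (ccEntry u v ∘ relabel q s) (1, 0) ≠
      lastRelPhase (ccEntry u v ∘ relabel q s) (0, 1) *
        lastRelPhase (ccEntry u v ∘ relabel q s) (1, 1) := by
  have h : v * star u ≠ 1 := fun h => huv (by linear_combination v * hu - u * h)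
  revert hqs
  fin_cases q <;> fin_cases s <;>
    simp [lastRelPhase, ccEntry, relabel, huv, huv1.symm] <;> exact h.symm

theorem lastRelPhase_ccEntry_ne'' {u v : ℂ} (hu : u * star u = 1) (huv : u ≠ v) (huv1 : u * v ≠ 1)
    {q s : Fin 3} (hqs : q ≠ s) :
    lastRelPhase (ccEntry u v ∘ relabel q s) (0, 0) *
        lastRelPhase (ccEntry u v ∘ relabel q s) (0, 1) ≠
      lastRelPhase (ccEntry u v ∘ relabel q s) (1, 0) *
        lastRelPhase (ccEntry u v ∘ relabel q s) (1, 1) := by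
  have h : v * star u ≠ 1 := fun h => huv (by linear_combination v * hu - u * h)
  revert hqs
  fin_cases q <;> fin_cases s <;>
    simp [lastRelPhase, ccEntry, relabel, huv, huv1.symm] <;> exact h.symm

theorem not_exists_three_gates {u v : ℂ} (hu : u * star u = 1) (hv : v * star v = 1) (huv : u ≠ v)
    {i j k : Fin 3} {X Y Z : Matrix ThreeQubits ThreeQubits ℂ} (hX : IsGateOff i X)
    (hY : IsGateOff j Y) (hZ : IsGateOff k Z) : X * Y * Z ≠ diagonal (ccEntry u v) := by
  have hg := ccEntry_mul_star hu hv
  have hiji : ∀ {i j : Fin 3} {X Y Z : Matrix ThreeQubits ThreeQubits ℂ}, i ≠ j → IsGateOff i X →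
      IsGateOff j Y → IsGateOff i Z → X * Y * Z ≠ diagonal (ccEntry u v) := by
    intro i j X Y Z hij hX hY hZ h
    -- Choosing `x` different from the target makes it a control, so the gate is trivial at `x = 0`.
    obtain ⟨x, y, hx, hxy, hxi, hyi⟩ :=
      (by decide : ∀ i : Fin 3, ∃ x y : Fin 3, x ≠ 2 ∧ x ≠ y ∧ x ≠ i ∧ y ≠ i) i
    refine false_of_alternating hxy hxi hyi hij.symm hX hY hZ (.one x) hg (by rw [mul_one, h])
      (relPhase_ccEntry_ne hu huv hxy) (Or.inr ⟨rfl, ?_⟩)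
    rintro ⟨b, c⟩
    have : x = 0 ∨ x = 1 := by omega
    rcases this with rfl | rfl <;> simp [ccEntry, relabel]
  have hij : ∀ {i j : Fin 3} {X Y : Matrix ThreeQubits ThreeQubits ℂ}, IsGateOff i X →
      IsGateOff j Y → X * Y ≠ diagonal (ccEntry u v) := by
    intro i j X Y hX hY h
    by_cases hij : i = j
    · subst hij
      have : i ≠ i + 1 := (by decide : ∀ i : Fin 3, i ≠ i + 1) i
      exact hiji this (hX.mul hY) (.one _) (.one _) (by rw [mul_one, mul_one, h])
    · exact hiji hij hX hY (.one _) (by rw [mul_one, h])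
  intro h
  by_cases h1 : i = j
  · subst h1
    exact hij (hX.mul hY) hZ h
  by_cases h2 : j = k
  · subst h2
    exact hij hX (hY.mul hZ) (by rw [← mul_assoc, h])
  by_cases h3 : i = k
  · subst h3
    exact hiji h1 hX hY hZ h
  · exact lastRelPhase_ccEntry_ne hu huv h2
      (mul_eq_mul_of_three_gates h2 (Ne.symm h1) (Ne.symm h3) hX hY hZ hg h)

theorem not_exists_four_gates {u v : ℂ} (hu : u * star u = 1) (hv : v * star v = 1) (huv : u ≠ v)
    (huv1 : u * v ≠ 1) {i j k l : Fin 3} {X Y Z W : Matrix ThreeQubits ThreeQubits ℂ}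
    (hX : IsGateOff i X) (hY : IsGateOff j Y) (hZ : IsGateOff k Z) (hW : IsGateOff l W) :
    X * Y * Z * W ≠ diagonal (ccEntry u v) := by
  have hg := ccEntry_mul_star hu hv
  have halt : ∀ {i j l : Fin 3} {X Y Z W : Matrix ThreeQubits ThreeQubits ℂ}, i ≠ j → i ≠ l →
      IsGateOff i X → IsGateOff j Y → IsGateOff i Z → IsGateOff l W →
        X * Y * Z * W ≠ diagonal (ccEntry u v) := by
    intro i j l X Y Z W hij hil hX hY hZ hW h
    obtain ⟨y, hly, hyi⟩ := (by decide : ∀ i l : Fin 3, ∃ y : Fin 3, l ≠ y ∧ y ≠ i) i l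
    exact false_of_alternating hly (Ne.symm hil) hyi hij.symm hX hY hZ hW hg h
      (relPhase_ccEntry_ne hu huv hly) (Or.inl (relPhase_ccEntry_ne' hu huv huv1 hly))
  intro h
  by_cases h1 : i = j
  · subst h1
    exact not_exists_three_gates hu hv huv (hX.mul hY) hZ hW h
  by_cases h2 : j = k
  · subst h2
    exact not_exists_three_gates hu hv huv hX (hY.mul hZ) hW (by rw [← h]; simp only [mul_assoc])
  by_cases h3 : k = l
  · subst h3
    exact not_exists_three_gates hu hv huv hX hY (hZ.mul hW) (by rw [← h]; simp only [mul_assoc])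
  by_cases h4 : i = k
  · subst h4
    exact halt h1 h3 hX hY hZ hW h
  by_cases h5 : j = l
  · subst h5
    -- The pattern `i j k j` is an alternating circuit read backwards.
    refine halt (Ne.symm h3) ?_ hW.transpose hZ.transpose hY.transpose hX.transpose ?_
    · exact Ne.symm h1
    · rw [← diagonal_transpose, ← h]
      simp only [transpose_mul, mul_assoc]
  · have h6 : i = l := by omega
    subst h6
    obtain ⟨U, hU, θ, -, hθ⟩ :=
      exists_algHom_of_cyclic h2 (Ne.symm h1) (Ne.symm h4) hX hY hZ hW hg h
    have hδ : ∀ s, lastRelPhase (ccEntry u v ∘ relabel j k) s *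
        star (lastRelPhase (ccEntry u v ∘ relabel j k) s) = 1 := by
      intro s
      simp only [lastRelPhase, star_mul, star_star, Function.comp_apply]
      linear_combination (ccEntry u v (relabel j k (s.1, s.2, 0)) *
        star (ccEntry u v (relabel j k (s.1, s.2, 0)))) * hg (relabel j k (s.1, s.2, 1)) +
          hg (relabel j k (s.1, s.2, 0))
    have key := diagonal_normalizer hU hδ θ hθ
    rcases mul_eq_zero.1 key with key | key
    · rcases mul_eq_zero.1 key with key | key
      · exact lastRelPhase_ccEntry_ne hu huv h2 (sub_eq_zero.1 key)
      · exact lastRelPhase_ccEntry_ne' hu huv huv1 h2 (sub_eq_zero.1 key)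
    · exact lastRelPhase_ccEntry_ne'' hu huv huv1 h2 (sub_eq_zero.1 key)

/-! ### Phases and padding of circuits -/

theorem phase_add (s t : ℝ) : phase (s + t) = phase s * phase t := by
  simp [phase, ← Complex.exp_add, add_mul]

theorem phase_zero : phase 0 = 1 := by simp [phase]

theorem star_phase (t : ℝ) : star (phase t) = phase (-t) := by
  rw [phase, phase, Complex.star_def, ← Complex.exp_conj]
  simp

theorem phase_mul_star (t : ℝ) : phase t * star (phase t) = 1 := by
  rw [star_phase, ← phase_add, add_neg_cancel, phase_zero]

theorem ccGate_eq (θ₁ θ₂ : ℝ) : ccGate θ₁ θ₂ = diagonal (ccEntry (phase θ₁) (phase θ₂)) := rfl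

theorem add_one_mem_gateCounts {G : Matrix ThreeQubits ThreeQubits ℂ} {k : ℕ}
    (h : k ∈ gateCounts G) : k + 1 ∈ gateCounts G := by
  obtain ⟨L, rfl, hL, hG⟩ := h
  refine ⟨1 :: L, rfl, ?_, by rw [List.prod_cons, one_mul, hG]⟩
  intro g hg
  rcases List.mem_cons.1 hg with rfl | hg
  · exact ⟨1, one_mem _, Or.inl onAB_one.symm⟩
  · exact hL g hg

theorem mem_gateCounts_of_le {G : Matrix ThreeQubits ThreeQubits ℂ} {k l : ℕ} (hkl : k ≤ l)
    (h : k ∈ gateCounts G) : l ∈ gateCounts G :=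
  Nat.le_induction h (fun _ _ => add_one_mem_gateCounts) l hkl

theorem three_notMem_gateCounts {θ₁ θ₂ : ℝ} (h : phase θ₁ ≠ phase θ₂) :
    3 ∉ gateCounts (ccGate θ₁ θ₂) := by
  rintro ⟨L, hlen, hL, hG⟩
  obtain ⟨X, Y, Z, rfl⟩ := List.length_eq_three.1 hlen
  obtain ⟨i, hX⟩ := (hL X (by simp)).exists_isGateOff
  obtain ⟨j, hY⟩ := (hL Y (by simp)).exists_isGateOff
  obtain ⟨k, hZ⟩ := (hL Z (by simp)).exists_isGateOff
  refine not_exists_three_gates (phase_mul_star _) (phase_mul_star _) h hX hY hZ ?_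
  rw [← ccGate_eq, ← hG]
  simp [mul_assoc]

theorem four_notMem_gateCounts {θ₁ θ₂ : ℝ} (h : phase θ₁ ≠ phase θ₂) (h1 : phase (θ₁ + θ₂) ≠ 1) :
    4 ∉ gateCounts (ccGate θ₁ θ₂) := by
  rintro ⟨L, hlen, hL, hG⟩
  rcases L with - | ⟨X, L⟩
  · simp at hlen
  obtain ⟨Y, Z, W, rfl⟩ := List.length_eq_three.1 (Nat.succ.inj hlen)
  obtain ⟨i, hX⟩ := (hL X (by simp)).exists_isGateOff
  obtain ⟨j, hY⟩ := (hL Y (by simp)).exists_isGateOff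
  obtain ⟨k, hZ⟩ := (hL Z (by simp)).exists_isGateOff
  obtain ⟨l, hW⟩ := (hL W (by simp)).exists_isGateOff
  rw [phase_add] at h1
  refine not_exists_four_gates (phase_mul_star _) (phase_mul_star _) h h1 hX hY hZ hW ?_
  rw [← ccGate_eq, ← hG]
  simp [mul_assoc]

/-! ### Explicit circuits with four and five gates -/

theorem diagonal_mem_unitaryGroup {n : Type*} [Fintype n] [DecidableEq n] {f : n → ℂ}
    (hf : ∀ i, f i * star (f i) = 1) : diagonal f ∈ unitaryGroup n ℂ := by
  rw [mem_unitaryGroup_iff, star_eq_conjTranspose, diagonal_conjTranspose, diagonal_mul_diagonal,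
    ← diagonal_one]
  exact congrArg diagonal (funext hf)

theorem controlled_diagonal (f : Fin 2 → ℂ) :
    controlled (diagonal f) = diagonal fun s => if s.1 = 1 then f s.2 else 1 := by
  ext ⟨a, c⟩ ⟨a', c'⟩
  fin_cases a <;> fin_cases a' <;> fin_cases c <;> fin_cases c' <;>
    simp [controlled, kroneckerMap_apply, single]

theorem controlled_diagonal_mem_unitaryGroup {f : Fin 2 → ℂ} (hf : ∀ i, f i * star (f i) = 1) :
    controlled (diagonal f) ∈ unitaryGroup TwoQubits ℂ := by
  rw [controlled_diagonal]
  refine diagonal_mem_unitaryGroup fun s => ?_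
  split_ifs
  · exact hf _
  · simp

theorem onAC_diagonal (f : TwoQubits → ℂ) :
    onAC (diagonal f) = diagonal fun p => f (p.1, p.2.2) := by
  ext ⟨a, b, c⟩ ⟨a', b', c'⟩
  simp only [onAC, of_apply, diagonal_apply, one_apply, Prod.mk.injEq]
  split_ifs <;> simp_all

theorem onBC_diagonal (f : TwoQubits → ℂ) : onBC (diagonal f) = diagonal fun p => f p.2 := by
  ext ⟨a, b, c⟩ ⟨a', b', c'⟩
  simp only [onBC, of_apply, diagonal_apply, one_apply, Prod.mk.injEq]
  split_ifs <;> simp_all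

/-- The permutation matrix of `e`. -/
def permGate {n : Type*} [DecidableEq n] (e : n ≃ n) : Matrix n n ℂ :=
  (1 : Matrix n n ℂ).submatrix e id

section permGate

variable {n : Type*} [Fintype n] [DecidableEq n] (e : n ≃ n)

theorem permGate_mul (M : Matrix n n ℂ) : permGate e * M = M.submatrix e id := by
  conv_lhs => rw [← submatrix_id_id M]
  rw [permGate]
  have := submatrix_mul_equiv (1 : Matrix n n ℂ) M e (Equiv.refl n) id
  rw [one_mul] at this
  exact this

theorem mul_permGate_conjTranspose (M : Matrix n n ℂ) :
    M * (permGate e)ᴴ = M.submatrix id e := by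
  rw [← conjTranspose_conjTranspose (M * _), conjTranspose_mul, conjTranspose_conjTranspose,
    permGate_mul]
  ext i j
  simp

theorem permGate_mem_unitaryGroup : permGate e ∈ unitaryGroup n ℂ := by
  rw [mem_unitaryGroup_iff, star_eq_conjTranspose, mul_permGate_conjTranspose, permGate,
    submatrix_submatrix]
  exact submatrix_one_equiv e

theorem permGate_conj_diagonal (f : n → ℂ) :
    permGate e * diagonal f * (permGate e)ᴴ = diagonal (f ∘ e) := by
  rw [permGate_mul, mul_permGate_conjTranspose, submatrix_submatrix]
  exact submatrix_diagonal_equiv f e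

end permGate

/-- The controlled-NOT permutation of two basis labels. -/
def cnotEquiv : TwoQubits ≃ TwoQubits where
  toFun s := (s.1, s.1 + s.2)
  invFun s := (s.1, s.1 + s.2)
  left_inv s := by revert s; decide
  right_inv s := by revert s; decide

theorem gateW_eq (θ : ℝ) : gateW θ = diagonal ![phase (-θ / 2), phase (θ / 2)] := rfl

theorem vec_phase_mul_star (s t : ℝ) (i : Fin 2) :
    (![phase s, phase t] : Fin 2 → ℂ) i * star ((![phase s, phase t] : Fin 2 → ℂ) i) = 1 := by
  fin_cases i
  exacts [phase_mul_star s, phase_mul_star t]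

theorem exists_conj_eq_parityPhase (θ : ℝ) : ∃ U ∈ unitaryGroup TwoQubits ℂ,
    U * ((1 : Matrix (Fin 2) (Fin 2) ℂ) ⊗ₖ gateW θ) * Uᴴ = parityPhase θ := by
  -- The added `1` makes the target label `1` exactly when the two bits agree, the case in which
  -- `parityPhase` is `phase (θ / 2)`.
  let e : TwoQubits ≃ TwoQubits :=
    { toFun := fun s => (s.1, s.1 + s.2 + 1)
      invFun := fun s => (s.1, s.1 + s.2 + 1)
      left_inv := fun s => by revert s; decide
      right_inv := fun s => by revert s; decide }
  refine ⟨permGate e, permGate_mem_unitaryGroup e, ?_⟩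
  rw [gateW_eq, ← diagonal_one, diagonal_kronecker_diagonal, permGate_conj_diagonal, parityPhase]
  congr 1
  ext ⟨b, c⟩
  fin_cases b <;> fin_cases c <;> simp [e]

/-- For `A = 0` the gates `U` and `Uᴴ` cancel. For `A = 1` the product is `W` times its parity
version, which is trivial for `b = 0` and squares `W` for `b = 1`. -/
theorem fourGateCircuit_implements {θ₁ θ₂ : ℝ} (h : phase (θ₁ + θ₂) = 1)
    {U : Matrix TwoQubits TwoQubits ℂ} (hU : U ∈ unitaryGroup TwoQubits ℂ)
    (hW : U * ((1 : Matrix (Fin 2) (Fin 2) ℂ) ⊗ₖ gateW θ₂) * Uᴴ = parityPhase θ₂) :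
    Implements (fourGateCircuit θ₂ U) (ccGate θ₁ θ₂) := by
  have hUU : U * Uᴴ = 1 := mem_unitaryGroup_iff.1 hU
  have hphase : phase θ₁ = phase (-θ₂) := by
    rw [phase_add] at h
    have h' := phase_mul_star θ₂
    rw [star_phase] at h'
    linear_combination phase (-θ₂) * h - phase θ₁ * h'
  have hctrl : controlled (gateW θ₂) ∈ unitaryGroup TwoQubits ℂ :=
    controlled_diagonal_mem_unitaryGroup (vec_phase_mul_star _ _)
  have hblock : ∀ i j, blockA i j (onAC (controlled (gateW θ₂))) =
      if i = j then (if i = 1 then (1 : Matrix (Fin 2) (Fin 2) ℂ) ⊗ₖ gateW θ₂ else 1) else 0 := by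
    intro i j
    rw [gateW_eq, controlled_diagonal, onAC_diagonal, blockA_diagonal, ← diagonal_one,
      diagonal_kronecker_diagonal]
    fin_cases i <;> fin_cases j <;> simp
  refine ⟨?_, ?_⟩
  · intro g hg
    simp only [fourGateCircuit, List.mem_cons, List.not_mem_nil, or_false] at hg
    rcases hg with rfl | rfl | rfl | rfl
    · exact ⟨_, hctrl, Or.inr (Or.inl rfl)⟩
    · exact ⟨U, hU, Or.inr (Or.inr rfl)⟩
    · exact ⟨_, hctrl, Or.inr (Or.inl rfl)⟩
    · exact ⟨Uᴴ, Unitary.star_mem hU, Or.inr (Or.inr rfl)⟩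
  · have hprod : (fourGateCircuit θ₂ U).prod = onAC (controlled (gateW θ₂)) *
        (onBC U * onAC (controlled (gateW θ₂)) * onBC Uᴴ) := by
      simp [fourGateCircuit, mul_assoc]
    rw [hprod]
    apply ext_blockA
    intro i j
    have e : ∀ i j, blockA i j (onBC U * onAC (controlled (gateW θ₂)) * onBC Uᴴ) =
        if i = j then (if i = 1 then parityPhase θ₂ else 1) else 0 := by
      intro i j
      rw [blockA_mul, blockA_mul, blockA_mul]
      simp only [hblock, blockA_onBC]
      fin_cases i <;> fin_cases j <;> simp [hUU, hW]
    have e11 : ((1 : Matrix (Fin 2) (Fin 2) ℂ) ⊗ₖ gateW θ₂) * parityPhase θ₂ =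
        diagonal fun s => ccEntry (phase θ₁) (phase θ₂) (1, s) := by
      rw [gateW_eq, ← diagonal_one, diagonal_kronecker_diagonal, parityPhase, diagonal_mul_diagonal,
        hphase]
      congr 1
      ext ⟨b, c⟩
      fin_cases b <;> fin_cases c <;>
        simp [ccEntry, ← phase_add, ← phase_zero] <;> ring_nf
    have e00 : (1 : Matrix TwoQubits TwoQubits ℂ) =
        diagonal fun s => ccEntry (phase θ₁) (phase θ₂) (0, s) := by
      rw [← diagonal_one]
      congr 1
    rw [blockA_mul, ccGate_eq, blockA_diagonal]
    simp only [hblock, e]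
    fin_cases i <;> fin_cases j <;> simp [e11, ← e00]

/-- Since `a + b - (a ⊕ b) = 2ab`, half phases controlled by `a` and by `b` and an inverse half
phase controlled by `a ⊕ b` combine to the full phase at `a = b = 1`. Conjugation by CNOT produces
the control on `a ⊕ b`. -/
theorem five_mem_gateCounts (θ₁ θ₂ : ℝ) : 5 ∈ gateCounts (ccGate θ₁ θ₂) := by
  let Q : Matrix (Fin 2) (Fin 2) ℂ := diagonal ![phase (θ₁ / 2), phase (θ₂ / 2)]
  let Q' : Matrix (Fin 2) (Fin 2) ℂ := diagonal ![phase (-(θ₁ / 2)), phase (-(θ₂ / 2))]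
  let e : ThreeQubits ≃ ThreeQubits :=
    { toFun := fun p => (p.1, p.1 + p.2.1, p.2.2)
      invFun := fun p => (p.1, p.1 + p.2.1, p.2.2)
      left_inv := fun s => by revert s; decide
      right_inv := fun s => by revert s; decide }
  have he : onAB (permGate cnotEquiv) = permGate e := by
    ext ⟨a, b, c⟩ ⟨a', b', c'⟩
    simp only [onAB, permGate, cnotEquiv, e, of_apply, submatrix_apply, one_apply, Prod.mk.injEq,
      Equiv.coe_fn_mk, id]
    by_cases h : a = a'
    · subst h
      split_ifs <;> simp_all
    · simp [h]
  have hcnot := permGate_mem_unitaryGroup cnotEquiv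
  have hQ : controlled Q ∈ unitaryGroup TwoQubits ℂ :=
    controlled_diagonal_mem_unitaryGroup (vec_phase_mul_star _ _)
  have hQ' : controlled Q' ∈ unitaryGroup TwoQubits ℂ :=
    controlled_diagonal_mem_unitaryGroup (vec_phase_mul_star _ _)
  refine ⟨[onAC (controlled Q), onAB (permGate cnotEquiv), onBC (controlled Q'),
    onAB (permGate cnotEquiv)ᴴ, onBC (controlled Q)], rfl, ?_, ?_⟩
  · intro g hg
    simp only [List.mem_cons, List.not_mem_nil, or_false] at hg
    rcases hg with rfl | rfl | rfl | rfl | rfl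
    · exact ⟨_, hQ, Or.inr (Or.inl rfl)⟩
    · exact ⟨_, hcnot, Or.inl rfl⟩
    · exact ⟨_, hQ', Or.inr (Or.inr rfl)⟩
    · exact ⟨_, Unitary.star_mem hcnot, Or.inl rfl⟩
    · exact ⟨_, hQ, Or.inr (Or.inr rfl)⟩
  · have hprod : [onAC (controlled Q), onAB (permGate cnotEquiv), onBC (controlled Q'),
        onAB (permGate cnotEquiv)ᴴ, onBC (controlled Q)].prod = onAC (controlled Q) *
          (permGate e * onBC (controlled Q') * (permGate e)ᴴ) * onBC (controlled Q) := by
      simp only [List.prod_cons, List.prod_nil, mul_one, ← onAB_conjTranspose, he, mul_assoc]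
    rw [hprod]
    simp only [Q, Q', controlled_diagonal, onAC_diagonal, onBC_diagonal]
    rw [permGate_conj_diagonal, diagonal_mul_diagonal, diagonal_mul_diagonal, ccGate_eq]
    congr 1
    ext ⟨a, b, c⟩
    fin_cases a <;> fin_cases b <;> fin_cases c <;>
      simp [e, ccEntry, ← phase_add, phase_zero]

theorem theorem4p3 :
    (∀ θ₁ θ₂ : ℝ, phase θ₁ ≠ phase θ₂ → phase (θ₁ + θ₂) ≠ 1 →
      IsLeast (gateCounts (ccGate θ₁ θ₂)) 5) ∧
    (∀ θ₁ θ₂ : ℝ, phase θ₁ ≠ phase θ₂ → phase (θ₁ + θ₂) = 1 →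
      IsLeast (gateCounts (ccGate θ₁ θ₂)) 4) ∧
    (∀ θ₁ θ₂ : ℝ, phase (θ₁ + θ₂) = 1 →
      (∃ U ∈ Matrix.unitaryGroup TwoQubits ℂ,
        U * ((1 : Matrix (Fin 2) (Fin 2) ℂ) ⊗ₖ gateW θ₂) * Uᴴ = parityPhase θ₂) ∧
      ∀ U ∈ Matrix.unitaryGroup TwoQubits ℂ,
        U * ((1 : Matrix (Fin 2) (Fin 2) ℂ) ⊗ₖ gateW θ₂) * Uᴴ = parityPhase θ₂ →
          Implements (fourGateCircuit θ₂ U) (ccGate θ₁ θ₂)) := by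
  refine ⟨fun θ₁ θ₂ h h1 => ⟨five_mem_gateCounts θ₁ θ₂, fun k hk => ?_⟩,
    fun θ₁ θ₂ h h1 => ⟨?_, fun k hk => ?_⟩,
    fun θ₁ θ₂ h => ⟨exists_conj_eq_parityPhase θ₂, fun U hU hW =>
      fourGateCircuit_implements h hU hW⟩⟩
  · by_contra! hlt
    exact four_notMem_gateCounts h h1 (mem_gateCounts_of_le (by omega) hk)
  · obtain ⟨U, hU, hW⟩ := exists_conj_eq_parityPhase θ₂
    exact ⟨_, rfl, fourGateCircuit_implements h1 hU hW⟩
  · by_contra! hlt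
    exact three_notMem_gateCounts h (mem_gateCounts_of_le (by omega) hk)
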